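/- Fix integers $N_1,T,K\ge 1$. Units $1,\dots,N_1$ are treated and the units $N_1+1,N_1+2,\dots$ are never treated; the sample with $N_0$ controls consists of the units $1,\dots,N=N_1+N_0$ observed in periods $t=1,\dots,T$. For a treated unit $j$ let $t_j^*\in\{1,\dots,T-1\}$ be the last period before treatment, and $t_j^*=\infty$ for controls. Potential outcomes are $y_{j,t}(0)=\theta_j+\gamma_t+\eta_{j,t}$ and $y_{j,t}(1)=\alpha_{j,t}+y_{j,t}(0)$ with nonrandom $\alpha_{j,t}$; the observed outcome is $y_{j,t}=y_{j,t}(1)$ if $t>t_j^*$ and $y_{j,t}=y_{j,t}(0)$ if $t\le t_j^*$. Write $\mathbf Y_j=(y_{j,1},\dots,y_{j,T})'$ and $\boldsymbol\eta_j=(\eta_{j,1},\dots,\eta_{j,T})'$, and let $Z_j$ be nonrandom covariates. Given $K_j\times T$ matrices $A_j$ and $K\times K_j$ matrices $B_j$ ($j\le N_1$), put $$\bar{\boldsymbol\alpha}=\sum_{j=1}^{N_1}B_jA_j\,(0,\dots,0,\alpha_{j,t_j^*+1},\dots,\alpha_{j,T})',\qquad \hat{\bar{\boldsymbol\alpha}}=\sum_{j=1}^{N_1}B_jA_j\Big[\mathbf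 Y_j-\frac1{N_0}\sum_{i=N_1+1}^{N}\mathbf Y_i\Big].$$ Assume: 1. (Sampling) The vectors $\boldsymbol\eta_1,\boldsymbol\eta_2,\dots$ are mutually independent with finite second moments; $\theta_j$ and $\gamma_t$ are arbitrary. 2. (Parallel trends) $B_jA_j\mathbb E[\boldsymbol\eta_j]=B_jA_j\mathbb E[\boldsymbol\eta_i]$ for all $j\le N_1<i$, and each row of $B_jA_j$ sums to zero. 3. (Parametric model) For each $j\le N_1$ and each $i\in\{j\}\cup\{N_1+1,N_1+2,\dots\}$, almost surely $B_jA_j\boldsymbol\eta_i=H_j(Z_i;\delta_j)\xi_{i,j}$, where $\delta_j\in\Delta_j\subseteq\mathbb R^{p_j}$ is unknown, $H_j$ is a known function (measurable in the parameter) and $H_j(Z_i;\delta_j)$ is a positive definite $K\times K$ matrix; for fixed $j$ all these $\xi_{i,j}$ have the same distribution, which has mean zero and is continuous in the sense that it gives no mass to any affine hyperplane of $\mathbb R^K$ (for $K=1$: its distribution function is continuous; any distribution with a density qualifies). 4. (Regularity) The estimators $\hat\delta_j$, measurable $\Delta_j$-valued functions of the observed data, satisfy for each $j\le N_1$, with $\|\cdot\|$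 the spectral norm, $\max_{i\in\{j,N_1+1,\dots,N\}}\|H_j(Z_i;\hat\delta_j)-H_j(Z_i;\delta_j)\|\overset{p}{\to}0$ as $N_0\to\infty$; and there are $0<\underline h\le\overline h<\infty$, not depending on $N_0$, such that for all $j\le N_1$, $\lambda_{\min}(H_j(Z_i;\delta_j))\ge\underline h$ for all controls $i$, and $\|H_j(Z_i;\delta_j)\|\le\overline h$ for $i=j$ and for all controls $i$. Bootstrap: put $\hat W_i(j)=B_jA_j\mathbf Y_i-\frac1{N_0}\sum_{i'=N_1+1}^{N}B_jA_j\mathbf Y_{i'}$ and $\widetilde W_i(j)=H_j(Z_i;\hat\delta_j)^{-1}\hat W_i(j)$ for the controls $i$ (where a singular matrix is given the inverse $0$; the matrices are invertible with probability tending to one). For $b=1,\dots,B$ draw $i_b(1),\dots,i_b(N_1)$ uniformly from $\{N_1+1,\dots,N\}$, all independent of each other and of $(\boldsymbol\eta_u,\theta_u,\gamma_t)_{u,t}$, and let $\hat e_b=\sum_{j=1}^{N_1}H_j(Z_j;\hat\delta_j)\widetilde W_{i_b(j)}(j)$. Let $\alpha\in(0,1)$. For random variables $\hat\iota_1,\dots,\hat\iota_K$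 (which may depend on $N_0$ and $B$) let $\hat q_{1-\alpha}$ be the empirical $(1-\alpha)$-quantile of $\max_{s}|\hat e_{b,s}/\hat\iota_s|$, $b=1,\dots,B$, that is, the smallest $c$ at which their empirical distribution function is at least $1-\alpha$, and let $$\mathcal C=\prod_{s=1}^K\big[\hat{\bar{\boldsymbol\alpha}}_s-\hat\iota_s\hat q_{1-\alpha},\ \hat{\bar{\boldsymbol\alpha}}_s+\hat\iota_s\hat q_{1-\alpha}\big].$$ If $\hat\iota_s\overset{p}{\to}\iota_s$ as $N_0,B\to\infty$ for constants $\iota_s>0$, $s=1,\dots,K$, then $$\lim_{N_0,B\to\infty}\mathbb P[\bar{\boldsymbol\alpha}\in\mathcal C]=1-\alpha.$$ Moreover, let $\hat\sigma_s^2$ be the empirical variance of $\hat e_{1,s},\dots,\hat e_{B,s}$ (with divisor $B$) and let $\sigma_s^2$ be the variance of the $s$-th coordinate of $\sum_{j=1}^{N_1}B_jA_j\boldsymbol\eta_j$. Then, for every $s$, $\sigma_s^2>0$ and $\hat\sigma_s^2\overset{p}{\to}\sigma_s^2$ as $N_0,B\to\infty$; in particular, the coverage statement holds for the choice $\hat\iota_s=\hat\sigma_s$.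 All limits $N_0,B\to\infty$ are joint, without restriction on the relative rates. -/

import Mathlib

open MeasureTheory ProbabilityTheory Filter Topology
open scoped Matrix ENNReal

noncomputable section

namespace FewTreatedDID

/-- The units: `Sum.inl j` with `j : Fin N₁` is a treated unit, and `Sum.inr i` with `i : ℕ` is the
`i`-th never-treated unit. The sample with `N₀` controls consists of all treated units and of the
controls `Sum.inr 0, …, Sum.inr (N₀ - 1)`. -/
abbrev PanelUnit (N₁ : ℕ) : Type := Fin N₁ ⊕ ℕ

/-- The units `{j} ∪ {controls}` (all controls of the infinite population list). -/
def ownAndControls {N₁ : ℕ} (j : Fin N₁) : Set (PanelUnit N₁) :=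
  insert (Sum.inl j) (Set.range Sum.inr)

/-- The units `{j} ∪ {controls}` of the sample with `N₀` controls. -/
def sampleOwnAndControls {N₁ : ℕ} (N₀ : ℕ) (j : Fin N₁) : Finset (PanelUnit N₁) :=
  insert (Sum.inl j) ((Finset.range N₀).image Sum.inr)

/-- The nonrandom ingredients: `T` periods (the element `t : Fin T` is period `t + 1`), `N₁` treated
units, a target parameter of dimension `K`, and covariates with values in `𝒵`. -/
structure Design (N₁ T K : ℕ) (𝒵 : Type*) where
  /-- the last period before the treated unit `j` enters into treatment -/
  lastPre : Fin N₁ → ℕ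
  one_le_lastPre : ∀ j, 1 ≤ lastPre j
  lastPre_lt : ∀ j, lastPre j < T
  /-- the (fixed, heterogeneous) treatment effects -/
  effect : PanelUnit N₁ → Fin T → ℝ
  /-- the number of building blocks of the treated unit `j` -/
  rows : Fin N₁ → ℕ
  /-- the building-block matrices `A_j` -/
  A : (j : Fin N₁) → Matrix (Fin (rows j)) (Fin T) ℝ
  /-- the aggregation matrices `B_j` -/
  B : (j : Fin N₁) → Matrix (Fin K) (Fin (rows j)) ℝ
  /-- the nonrandom covariates `Z_i` -/
  Z : PanelUnit N₁ → 𝒵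
  /-- the dimension of the parameter of the heteroskedasticity model of unit `j` -/
  dim : Fin N₁ → ℕ
  /-- the parameter space `Δ_j ⊆ ℝ^{p_j}` -/
  Param : (j : Fin N₁) → Set (Fin (dim j) → ℝ)
  /-- the true parameter `δ_j` -/
  δ : (j : Fin N₁) → Param j
  /-- the known function `H_j(z; d)` -/
  H : (j : Fin N₁) → 𝒵 → Param j → Matrix (Fin K) (Fin K) ℝ
  /-- measurability of `H_j(z; d)` in the parameter -/
  measurable_H : ∀ j z k l, Measurable fun d : Param j => H j z d k l

/-- The unobserved random variables: unit effects, time effects and shocks. -/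
structure Unobserved (N₁ T : ℕ) (Ω : Type*) where
  θ : PanelUnit N₁ → Ω → ℝ
  γ : Fin T → Ω → ℝ
  η : PanelUnit N₁ → Ω → Fin T → ℝ

/-- An estimation rule for `δ_1, …, δ_{N₁}`: for each number `N₀` of controls and each `j`, a
measurable function of the outcomes of the `N₁` treated units and the `N₀` controls. -/
structure ParamEstimator {N₁ T K : ℕ} {𝒵 : Type*} (D : Design N₁ T K 𝒵) where
  est : (N₀ : ℕ) → (j : Fin N₁) → (Fin N₁ ⊕ Fin N₀ → Fin T → ℝ) → D.Param j
  measurable_est : ∀ N₀ j, Measurable (est N₀ j)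

/-- The spectral norm of a square real matrix. -/
def specNorm {K : ℕ} (M : Matrix (Fin K) (Fin K) ℝ) : ℝ :=
  ‖Matrix.toEuclideanCLM (n := Fin K) (𝕜 := ℝ) M‖

/-- The smallest eigenvalue of a symmetric real matrix of positive size. -/
def lambdaMin {K : ℕ} (M : Matrix (Fin K) (Fin K) ℝ) : ℝ :=
  sInf (spectrum ℝ M)

/-- A continuous distribution on `ℝ^K`: no affine hyperplane has positive mass, i.e. every
nontrivial linear combination of the coordinates has a continuous distribution function. For `K = 1`
this says that the distribution function is continuous; distributions with a density satisfy it. -/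
def ContinuousDistribution {K : ℕ} (μ : Measure (Fin K → ℝ)) : Prop :=
  ∀ a : Fin K → ℝ, a ≠ 0 → ∀ c : ℝ, μ {x | a ⬝ᵥ x = c} = 0

/-- The empirical `p`-quantile of `x 0, …, x (B - 1)`: the smallest `c` at which the empirical
distribution function is at least `p`. -/
def empQuantile (B : ℕ) (x : ℕ → ℝ) (p : ℝ) : ℝ :=
  sInf {c : ℝ | p ≤ (((Finset.range B).filter fun b => x b ≤ c).card : ℝ) / B}

/-- The empirical variance of `x 0, …, x (B - 1)`. -/
def empVariance (B : ℕ) (x : ℕ → ℝ) : ℝ :=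
  (∑ b ∈ Finset.range B, (x b - (∑ b' ∈ Finset.range B, x b') / B) ^ 2) / B

section Observed

variable {N₁ T K : ℕ} {𝒵 Ω : Type*}

/-- The last period before treatment, `∞` for the controls. -/
def Design.lastPreUnit (D : Design N₁ T K 𝒵) : PanelUnit N₁ → ℕ∞
  | Sum.inl j => (D.lastPre j : ℕ∞)
  | Sum.inr _ => ⊤

/-- Unit `u` is treated in period `t + 1`. -/
def Design.IsTreated (D : Design N₁ T K 𝒵) (u : PanelUnit N₁) (t : Fin T) : Prop :=
  D.lastPreUnit u < (((t : ℕ) + 1 : ℕ) : ℕ∞)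

/-- The matrix `B_j A_j`. -/
def Design.BA (D : Design N₁ T K 𝒵) (j : Fin N₁) : Matrix (Fin K) (Fin T) ℝ :=
  D.B j * D.A j

open Classical in
/-- The vector `(0, …, 0, α_{j, t_j^* + 1}, …, α_{j, T})` of identifiable treatment effects. -/
def Design.effectVec (D : Design N₁ T K 𝒵) (j : Fin N₁) (t : Fin T) : ℝ :=
  if D.IsTreated (Sum.inl j) t then D.effect (Sum.inl j) t else 0

/-- The target parameter `∑_j B_j A_j α_j`. -/
def Design.target (D : Design N₁ T K 𝒵) : Fin K → ℝ :=
  ∑ j, D.BA j *ᵥ D.effectVec j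

/-- The untreated potential outcomes `θ_j + γ_t + η_{j,t}`. -/
def Unobserved.outcomeUntreated (U : Unobserved N₁ T Ω) (u : PanelUnit N₁) (t : Fin T) (ω : Ω) : ℝ :=
  U.θ u ω + U.γ t ω + U.η u ω t

/-- The treated potential outcomes. -/
def outcomeTreated (D : Design N₁ T K 𝒵) (U : Unobserved N₁ T Ω) (u : PanelUnit N₁) (t : Fin T)
    (ω : Ω) : ℝ :=
  D.effect u t + U.outcomeUntreated u t ω

open Classical in
/-- The observed outcomes `Y_u = (y_{u,1}, …, y_{u,T})`. -/
def outcome (D : Design N₁ T K 𝒵) (U : Unobserved N₁ T Ω) (u : PanelUnit N₁) (ω : Ω) (t : Fin T) :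
    ℝ :=
  if D.IsTreated u t then outcomeTreated D U u t ω else U.outcomeUntreated u t ω

/-- The average of the outcome vectors of the first `N₀` controls. -/
def controlMean (D : Design N₁ T K 𝒵) (U : Unobserved N₁ T Ω) (N₀ : ℕ) (ω : Ω) : Fin T → ℝ :=
  (N₀ : ℝ)⁻¹ • ∑ i ∈ Finset.range N₀, outcome D U (Sum.inr i) ω

/-- The estimator `∑_j B_j A_j [Y_j - N₀⁻¹ ∑_i Y_i]` of the target parameter. -/
def estimator (D : Design N₁ T K 𝒵) (U : Unobserved N₁ T Ω) (N₀ : ℕ) (ω : Ω) : Fin K → ℝ :=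
  ∑ j, D.BA j *ᵥ (outcome D U (Sum.inl j) ω - controlMean D U N₀ ω)

/-- The outcomes of the sample with `N₀` controls. -/
def sampleOutcomes (D : Design N₁ T K 𝒵) (U : Unobserved N₁ T Ω) (N₀ : ℕ) (ω : Ω) :
    Fin N₁ ⊕ Fin N₀ → Fin T → ℝ :=
  fun v => outcome D U (Sum.map id Fin.val v) ω

/-- The estimator `δ̂_j` in the sample with `N₀` controls. -/
def deltaHat {D : Design N₁ T K 𝒵} (E : ParamEstimator D) (U : Unobserved N₁ T Ω) (N₀ : ℕ)
    (j : Fin N₁) (ω : Ω) : D.Param j :=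
  E.est N₀ j (sampleOutcomes D U N₀ ω)

/-- The residual `Ŵ_i(j)` of the `i`-th control. -/
def residual (D : Design N₁ T K 𝒵) (U : Unobserved N₁ T Ω) (N₀ : ℕ) (j : Fin N₁) (i : ℕ) (ω : Ω) :
    Fin K → ℝ :=
  D.BA j *ᵥ outcome D U (Sum.inr i) ω
    - (N₀ : ℝ)⁻¹ • ∑ i' ∈ Finset.range N₀, D.BA j *ᵥ outcome D U (Sum.inr i') ω

/-- The normalized residual `W̃_i(j) = H_j(Z_i; δ̂_j)⁻¹ Ŵ_i(j)` of the `i`-th control. -/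
def normResidual {D : Design N₁ T K 𝒵} (E : ParamEstimator D) (U : Unobserved N₁ T Ω) (N₀ : ℕ)
    (j : Fin N₁) (i : ℕ) (ω : Ω) : Fin K → ℝ :=
  (D.H j (D.Z (Sum.inr i)) (deltaHat E U N₀ j ω))⁻¹ *ᵥ residual D U N₀ j i ω

/-- The bootstrap errors `ê_b = ∑_j H_j(Z_j; δ̂_j) W̃_{i_b(j)}(j)`. The control that is drawn for unit
`j` in replication `b`, in the sample with `N₀` controls, is `draw N₀ b j`. -/
def bootError {D : Design N₁ T K 𝒵} (E : ParamEstimator D) (U : Unobserved N₁ T Ω)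
    (draw : ℕ → ℕ → Fin N₁ → Ω → ℕ) (N₀ b : ℕ) (ω : Ω) : Fin K → ℝ :=
  ∑ j, D.H j (D.Z (Sum.inl j)) (deltaHat E U N₀ j ω) *ᵥ normResidual E U N₀ j (draw N₀ b j ω) ω

/-- The critical value: the empirical `(1 - α)`-quantile of `max_s |ê_{b,s} / ι_s|`, `b < B`. -/
def critValue {D : Design N₁ T K 𝒵} (E : ParamEstimator D) (U : Unobserved N₁ T Ω)
    (draw : ℕ → ℕ → Fin N₁ → Ω → ℕ) (N₀ B : ℕ) (α : ℝ) (ι : Fin K → ℝ) (ω : Ω) : ℝ :=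
  empQuantile B (fun b => ⨆ s, |bootError E U draw N₀ b ω s / ι s|) (1 - α)

/-- The rectangular band with normalizing constants `ι`. -/
def band {D : Design N₁ T K 𝒵} (E : ParamEstimator D) (U : Unobserved N₁ T Ω)
    (draw : ℕ → ℕ → Fin N₁ → Ω → ℕ) (N₀ B : ℕ) (α : ℝ) (ι : Fin K → ℝ) (ω : Ω) :
    Set (Fin K → ℝ) :=
  Set.pi Set.univ fun s =>
    Set.Icc (estimator D U N₀ ω s - ι s * critValue E U draw N₀ B α ι ω)
      (estimator D U N₀ ω s + ι s * critValue E U draw N₀ B α ι ω)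

/-- The bootstrap variance estimator `σ̂_s²`: the empirical variance of `ê_{b,s}`, `b < B`. -/
def bootVariance {D : Design N₁ T K 𝒵} (E : ParamEstimator D) (U : Unobserved N₁ T Ω)
    (draw : ℕ → ℕ → Fin N₁ → Ω → ℕ) (N₀ B : ℕ) (s : Fin K) (ω : Ω) : ℝ :=
  empVariance B fun b => bootError E U draw N₀ b ω s

/-- The variance `σ_s²` of the `s`-th coordinate of `∑_j B_j A_j η_j`. -/
def limitVariance [MeasurableSpace Ω] (P : Measure Ω) (D : Design N₁ T K 𝒵)
    (U : Unobserved N₁ T Ω) (s : Fin K) : ℝ :=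
  variance (fun ω => (∑ j, D.BA j *ᵥ U.η (Sum.inl j) ω) s) P

/-- The deviation `max_i ‖H_j(Z_i; δ̂_j) - H_j(Z_i; δ_j)‖` over unit `j` and the `N₀` controls. -/
def maxDeviation {D : Design N₁ T K 𝒵} (E : ParamEstimator D) (U : Unobserved N₁ T Ω) (N₀ : ℕ)
    (j : Fin N₁) (ω : Ω) : ℝ :=
  (sampleOwnAndControls N₀ j).sup' (Finset.insert_nonempty _ _) fun u =>
    specNorm (D.H j (D.Z u) (deltaHat E U N₀ j ω) - D.H j (D.Z u) (D.δ j))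

end Observed

section Assumptions

variable {N₁ T K : ℕ} {𝒵 Ω : Type*} [MeasurableSpace Ω]

/-- Sampling: the shock vectors are mutually independent across units, with finite second moments.
Nothing but measurability is asked of the unit and time effects. -/
structure Sampling (P : Measure Ω) (U : Unobserved N₁ T Ω) : Prop where
  measurable_θ : ∀ u, Measurable (U.θ u)
  measurable_γ : ∀ t, Measurable (U.γ t)
  measurable_η : ∀ u, Measurable (U.η u)
  indep : iIndepFun U.η P
  secondMoment : ∀ u t, MemLp (fun ω => U.η u ω t) 2 P

/-- Parallel trends; the rows of `B_j A_j` sum to zero. -/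
structure ParallelTrends (P : Measure Ω) (D : Design N₁ T K 𝒵) (U : Unobserved N₁ T Ω) : Prop where
  mean_eq : ∀ (j : Fin N₁) (i : ℕ),
    D.BA j *ᵥ (fun t => ∫ ω, U.η (Sum.inl j) ω t ∂P)
      = D.BA j *ᵥ (fun t => ∫ ω, U.η (Sum.inr i) ω t ∂P)
  rowSum : ∀ (j : Fin N₁) (k : Fin K), ∑ t, D.BA j k t = 0

/-- The parametric model of heteroskedasticity: `B_j A_j η_i = H_j(Z_i; δ_j) ξ_{i,j}`. -/
structure ParametricModel (P : Measure Ω) (D : Design N₁ T K 𝒵) (U : Unobserved N₁ T Ω)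
    (ξ : PanelUnit N₁ → Fin N₁ → Ω → Fin K → ℝ) : Prop where
  posDef : ∀ j, ∀ u ∈ ownAndControls j, (D.H j (D.Z u) (D.δ j)).PosDef
  model : ∀ j, ∀ u ∈ ownAndControls j,
    ∀ᵐ ω ∂P, D.BA j *ᵥ U.η u ω = D.H j (D.Z u) (D.δ j) *ᵥ ξ u j ω
  identDistrib : ∀ j, ∀ u ∈ ownAndControls j, ∀ u' ∈ ownAndControls j,
    IdentDistrib (ξ u j) (ξ u' j) P P
  continuous : ∀ j, ContinuousDistribution (P.map (ξ (Sum.inl j) j))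
  mean_zero : ∀ j k, ∫ ω, ξ (Sum.inl j) j ω k ∂P = 0

/-- The regularity conditions: uniform consistency of the estimated `H_j`, and uniform bounds for the
true ones. -/
structure Regularity (P : Measure Ω) (D : Design N₁ T K 𝒵) (E : ParamEstimator D)
    (U : Unobserved N₁ T Ω) : Prop where
  consistent : ∀ j, TendstoInMeasure P (fun N₀ ω => maxDeviation E U N₀ j ω) atTop fun _ => 0
  bounds : ∃ hlow hup : ℝ, 0 < hlow ∧ hlow ≤ hup ∧
    (∀ (j : Fin N₁) (i : ℕ), hlow ≤ lambdaMin (D.H j (D.Z (Sum.inr i)) (D.δ j))) ∧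
    (∀ j, ∀ u ∈ ownAndControls j, specNorm (D.H j (D.Z u) (D.δ j)) ≤ hup)

/-- The bootstrap draws: in the sample with `N₀ ≥ 1` controls, the draws `draw N₀ b j` are independent
and uniform on the `N₀` controls, and independent of everything that determines the data. -/
structure BootstrapDraws (P : Measure Ω) (U : Unobserved N₁ T Ω)
    (draw : ℕ → ℕ → Fin N₁ → Ω → ℕ) : Prop where
  measurable_draw : ∀ N₀ b j, Measurable (draw N₀ b j)
  uniform : ∀ N₀ b j, ∀ i < N₀, P {ω | draw N₀ b j ω = i} = (N₀ : ℝ≥0∞)⁻¹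
  indep : ∀ N₀, 0 < N₀ → iIndepFun (fun (bj : ℕ × Fin N₁) => draw N₀ bj.1 bj.2) P
  indep_data : ∀ N₀, 0 < N₀ →
    IndepFun (fun ω => ((fun u => U.η u ω), (fun u => U.θ u ω), (fun t => U.γ t ω)))
      (fun ω (bj : ℕ × Fin N₁) => draw N₀ bj.1 bj.2 ω) P

end Assumptions

end FewTreatedDID

end

open FewTreatedDID

/-!
The coverage event is the comparison of a studentized estimation error with a random critical value,
and both are governed by the same law. Write `ζ_{u,j} = H_j(Z_u; δ_j)⁻¹ B_j A_j η_u` (`normShock`), a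
measurable version of `ξ_{u,j}`. As the rows of `B_j A_j` sum to zero, unit effects drop out, time
effects cancel against the control mean, and the estimation error is `∑_j H_j(Z_j; δ_j) ζ_{j,j}`
(`aggregate` of `ownShocks`) up to the control means of the `B_j A_j η_i`. These vanish by Chebyshev's
inequality: by the model the shocks are centred, with uniformly bounded second moments
(`tendsto_meanShock`). The bootstrap errors are, uniformly in the replication, within
`r (1 + ‖x_b‖)`, `r → 0` in probability, of `aggregate D x_b`, where `x_b` collects the `ζ_{i_b(j),j}`
of the drawn controls (`norm_rescale_sub_le`, `exists_bootError_bound`).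

The drawn vectors behave like an i.i.d. sample from the law `Q` of `ownShocks`: unless two draws
coincide, which has probability `O(1 / N₀)`, they are independent with the right marginals. So for a
bounded `f` with `∫ f dQ = 0` the second moment of the average of `f(x_b)` is `O(1 / B + 1 / N₀)`, without
conditioning on the data (`Resampling.integral_average_sq_le`). Truncation extends this law of large
numbers to functions of quadratic growth (`Resampling.tendsto_average`), because each coordinate of
`x_b` has exactly the marginal law of `Q`.

Applied to first and second powers, it gives the consistency of the bootstrap variances
(`tendsto_bootVariance`). Applied to indicators of `W(x) ± η (1 + ‖x‖) ≤ c`, with `W` the studentized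
maximum, it places the empirical quantile above each `c` with `Q(W ≤ c) < 1 - α` and below each `c` with
`Q(W ≤ c) > 1 - α` (`eventually_critValue`). The continuity of the distribution of `ζ_{j,j}` makes `W`
atomless (`measure_maxRatio_aggregate_eq`), so that `Q(W ≤ c)` takes all values in `(0, 1)` and a sandwich
argument yields the coverage `1 - α` (`tendsto_measureReal_le_critical`), whether or not the quantile of
`W` is unique. Convergence in probability is handled throughout as convergence along a filter
(`inProb`) of events whose probability tends to one.
-/

open FewTreatedDID

/-! ### Convergence in probability as a filter -/

namespace FewTreatedDID

section InProbability

variable {Ω ι κ : Type*} [MeasurableSpace Ω] {P : Measure Ω} {l : Filter ι}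

/-- The filter of the events `S` (depending on an index) whose probability tends to one along `l`.
Convergence along it is convergence in probability, and `∀ᶠ` along it reads "with probability
tending to one". It is phrased through the outer measure of the complements, so that no
measurability is required. -/
def inProb (P : Measure Ω) (l : Filter ι) : Filter (ι × Ω) where
  sets := {S | Tendsto (fun n => P {ω | (n, ω) ∉ S}) l (𝓝 0)}
  univ_sets := by simpa using tendsto_const_nhds
  sets_of_superset := by
    intro S S' hS hSS'
    refine tendsto_of_tendsto_of_tendsto_of_le_of_le tendsto_const_nhds hS (fun _ => zero_le)
      fun n => measure_mono fun ω hω h => hω (hSS' h)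
  inter_sets := by
    intro S S' hS hS'
    have h := Tendsto.add hS hS'
    rw [add_zero] at h
    refine tendsto_of_tendsto_of_tendsto_of_le_of_le tendsto_const_nhds h (fun _ => zero_le)
      fun n => ?_
    refine (measure_mono ?_).trans (measure_union_le _ _)
    intro ω hω
    by_contra hc
    simp only [Set.mem_union, Set.mem_ofPred_eq, not_or, not_not] at hc
    exact hω hc

theorem eventually_inProb_iff {q : ι × Ω → Prop} :
    (∀ᶠ p in inProb P l, q p) ↔ Tendsto (fun n => P {ω | ¬ q (n, ω)}) l (𝓝 0) :=
  Iff.rfl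

theorem tendstoInMeasure_const_iff {E : Type*} [PseudoMetricSpace E] {f : ι → Ω → E} {c : E} :
    TendstoInMeasure P f l (fun _ => c) ↔
      Tendsto (fun p : ι × Ω => f p.1 p.2) (inProb P l) (𝓝 c) := by
  rw [tendstoInMeasure_iff_dist, Metric.tendsto_nhds]
  simp only [eventually_inProb_iff, not_lt, gt_iff_lt]

theorem tendsto_inProb_of_index {lκ : Filter κ} {u : ι → κ} (hu : Tendsto u l lκ) :
    Tendsto (fun p : ι × Ω => (u p.1, p.2)) (inProb P l) (inProb P lκ) := by
  intro S hS
  exact Tendsto.comp (g := fun n => P {ω | (n, ω) ∉ S}) hS hu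

theorem eventually_inProb_of_ae {q : ι → Ω → Prop} (h : ∀ᶠ n in l, ∀ᵐ ω ∂P, q n ω) :
    ∀ᶠ p in inProb P l, q p.1 p.2 := by
  rw [eventually_inProb_iff]
  refine tendsto_const_nhds.congr' ?_
  filter_upwards [h] with n hn
  exact (ae_iff.1 hn).symm

theorem eventually_inProb_of_eventually {q : ι → Prop} (h : ∀ᶠ n in l, q n) :
    ∀ᶠ p in inProb P l, q p.1 :=
  eventually_inProb_of_ae (q := fun n _ => q n) (h.mono fun _ hn => Eventually.of_forall fun _ => hn)

/-- Chebyshev's inequality: vanishing second moments imply convergence in probability. -/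
theorem tendsto_inProb_of_integral_sq {f : ι → Ω → ℝ}
    (hf : ∀ n, MemLp (f n) 2 P) (h : Tendsto (fun n => ∫ ω, f n ω ^ 2 ∂P) l (𝓝 0)) :
    Tendsto (fun p : ι × Ω => f p.1 p.2) (inProb P l) (𝓝 0) := by
  rw [← tendstoInMeasure_const_iff]
  refine tendstoInMeasure_of_tendsto_eLpNorm (p := 2) (by simp) (fun n => (hf n).1)
    aestronglyMeasurable_const ?_
  have key : ∀ n, eLpNorm (f n - fun _ => (0 : ℝ)) 2 P
      = ENNReal.ofReal ((∫ ω, f n ω ^ 2 ∂P) ^ ((1 : ℝ) / 2)) := by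
    intro n
    have : (f n - fun _ => (0 : ℝ)) = f n := by ext; simp
    rw [this, (hf n).eLpNorm_eq_integral_rpow_norm (by simp) (by simp)]
    simp
  simp_rw [key]
  have h2 := (h.rpow_const (p := (1 : ℝ) / 2) (Or.inr (by norm_num)))
  rw [Real.zero_rpow (by norm_num)] at h2
  simpa using ENNReal.tendsto_ofReal h2

/-- Approximation in mean: `f` converges in probability if it is within `g k` of a sequence that
does, where the expectation of `g k` is small uniformly in the index. -/
theorem tendsto_inProb_of_approx {f : ι → Ω → ℝ} {fk : ℕ → ι → Ω → ℝ} {g : ℕ → ι → Ω → ℝ}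
    {c : ℝ} {ck : ℕ → ℝ} {ε : ℕ → ℝ≥0∞}
    (hdiff : ∀ k n ω, |f n ω - fk k n ω| ≤ g k n ω)
    (hg : ∀ k n, AEMeasurable (g k n) P)
    (hgε : ∀ k, ∀ᶠ n in l, ∫⁻ ω, ENNReal.ofReal (g k n ω) ∂P ≤ ε k)
    (hε : Tendsto ε atTop (𝓝 0)) (hck : Tendsto ck atTop (𝓝 c))
    (hfk : ∀ k, Tendsto (fun p : ι × Ω => fk k p.1 p.2) (inProb P l) (𝓝 (ck k))) :
    Tendsto (fun p : ι × Ω => f p.1 p.2) (inProb P l) (𝓝 c) := by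
  rw [Metric.tendsto_nhds]
  intro δ hδ
  rw [eventually_inProb_iff, ENNReal.tendsto_nhds_zero]
  intro η hη
  -- by Markov's inequality `g k` exceeds `δ / 3` with probability at most `ε k / (δ / 3)`
  have hδ3 : 0 < δ / 3 := by positivity
  have hmul : Tendsto (fun k => ε k / ENNReal.ofReal (δ / 3)) atTop (𝓝 0) := by
    have := ENNReal.Tendsto.div_const hε (Or.inr (by simpa using hδ) : (0 : ℝ≥0∞) ≠ 0 ∨ ENNReal.ofReal (δ / 3) ≠ 0)
    simpa using this
  have hη2 : 0 < η / 2 := ENNReal.half_pos hη.ne'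
  obtain ⟨k, hk1, hk2⟩ := ((ENNReal.tendsto_nhds_zero.1 hmul _ hη2).and
    (Metric.tendsto_nhds.1 hck _ hδ3)).exists
  have hev := ENNReal.tendsto_nhds_zero.1 (eventually_inProb_iff.1
    (Metric.tendsto_nhds.1 (hfk k) _ hδ3)) _ hη2
  filter_upwards [hev, hgε k] with n hn hn'
  have hsub : {ω | ¬ dist (f n ω) c < δ} ⊆
      {ω | ¬ dist (fk k n ω) (ck k) < δ / 3} ∪
        {ω | ENNReal.ofReal (δ / 3) ≤ ENNReal.ofReal (g k n ω)} := by
    intro ω hω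
    by_contra hc
    simp only [Set.mem_union, Set.mem_ofPred_eq, not_or, not_not, not_le] at hc
    refine hω ?_
    have h1 := (ENNReal.ofReal_lt_ofReal_iff hδ3).1 hc.2
    have h2 := hdiff k n ω
    calc dist (f n ω) c ≤ dist (f n ω) (fk k n ω) + dist (fk k n ω) (ck k) + dist (ck k) c :=
          dist_triangle4 _ _ _ _
      _ < δ / 3 + δ / 3 + δ / 3 := by
          have h3 : dist (f n ω) (fk k n ω) < δ / 3 := by rw [Real.dist_eq]; linarith
          have h4 := hc.1
          linarith
      _ = δ := by ring
  calc P {ω | ¬ dist (f n ω) c < δ} ≤ _ := (measure_mono hsub).trans (measure_union_le _ _)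
    _ ≤ η / 2 + η / 2 := by
        refine add_le_add hn (le_trans ?_ hk1)
        refine (meas_ge_le_lintegral_div (hg k n).ennreal_ofReal (by simpa using hδ)
          ENNReal.ofReal_ne_top).trans ?_
        gcongr
    _ = η := ENNReal.add_halves η

/-- The event `S n` may be nonmeasurable. -/
theorem eventually_measureReal_le_of_imp [IsFiniteMeasure P] {S : ι → Set Ω} {S' : Set Ω}
    (h : ∀ᶠ p in inProb P l, p.2 ∈ S p.1 → p.2 ∈ S') {ε : ℝ} (hε : 0 < ε) :
    ∀ᶠ n in l, P.real (S n) ≤ P.real S' + ε := by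
  have h1 := (ENNReal.tendsto_toReal (by simp)).comp (eventually_inProb_iff.1 h)
  filter_upwards [(tendsto_order.1 h1).2 ε (by simpa using hε)] with n hn
  have hsub : S n ⊆ S' ∪ {ω | ¬ (ω ∈ S n → ω ∈ S')} := by
    intro ω hω
    by_cases h' : ω ∈ S'
    · exact Or.inl h'
    · exact Or.inr fun hc => h' (hc hω)
  calc P.real (S n) ≤ _ := (measureReal_mono hsub).trans (measureReal_union_le _ _)
    _ ≤ P.real S' + ε := by gcongr; exact hn.le

/-- The event `S n` may be nonmeasurable. -/
theorem eventually_le_measureReal_of_imp [IsFiniteMeasure P] {S : ι → Set Ω} {S' : Set Ω}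
    (h : ∀ᶠ p in inProb P l, p.2 ∈ S' → p.2 ∈ S p.1) {ε : ℝ} (hε : 0 < ε) :
    ∀ᶠ n in l, P.real S' ≤ P.real (S n) + ε := by
  have h1 := (ENNReal.tendsto_toReal (by simp)).comp (eventually_inProb_iff.1 h)
  filter_upwards [(tendsto_order.1 h1).2 ε (by simpa using hε)] with n hn
  have hsub : S' ⊆ S n ∪ {ω | ¬ (ω ∈ S' → ω ∈ S n)} := by
    intro ω hω
    by_cases h' : ω ∈ S n
    · exact Or.inl h'
    · exact Or.inr fun hc => h' (hc hω)
  calc P.real S' ≤ _ := (measureReal_mono hsub).trans (measureReal_union_le _ _)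
    _ ≤ P.real (S n) + ε := by gcongr; exact hn.le

end InProbability

end FewTreatedDID

/-! ### Laws of large numbers for resampled vectors -/

namespace FewTreatedDID

section Resampling

variable {Ω J E κ : Type*} [MeasurableSpace Ω] {P : Measure Ω} [MeasurableSpace E]

theorem measurable_select {ζ : ℕ → Ω → E} (hζ : ∀ i, Measurable (ζ i)) {d : Ω → ℕ}
    (hd : Measurable d) : Measurable fun ω => ζ (d ω) ω := by
  have h : Measurable fun q : ℕ × Ω => ζ q.1 q.2 :=
    measurable_from_prod_countable_right fun i => hζ i
  exact h.comp (hd.prodMk measurable_id)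

/-- Selecting one of identically distributed variables by an independent random index does not change
the distribution. -/
theorem map_select [IsProbabilityMeasure P] {ζ : ℕ → Ω → E} {ν : Measure E}
    (hζ : ∀ i, Measurable (ζ i)) (hlaw : ∀ i, P.map (ζ i) = ν) {d : Ω → ℕ} (hd : Measurable d)
    (hind : ∀ i, IndepFun (ζ i) d P) : P.map (fun ω => ζ (d ω) ω) = ν := by
  ext A hA
  rw [Measure.map_apply (measurable_select hζ hd) hA]
  have hpart : (fun ω => ζ (d ω) ω) ⁻¹' A = ⋃ i, (ζ i ⁻¹' A ∩ d ⁻¹' {i}) := by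
    ext ω; simp
  have huniv : (Set.univ : Set Ω) = ⋃ i, d ⁻¹' {i} := by ext ω; simp
  have hdisj : Pairwise (Function.onFun Disjoint fun i => d ⁻¹' {i}) := by
    intro i i' hii'
    exact Disjoint.preimage _ (by simpa using hii')
  rw [hpart, measure_iUnion]
  · have : ∀ i, P (ζ i ⁻¹' A ∩ d ⁻¹' {i}) = ν A * P (d ⁻¹' {i}) := by
      intro i
      rw [(hind i).measure_inter_preimage_eq_mul _ _ hA (measurableSet_singleton i), ← hlaw i,
        Measure.map_apply (hζ i) hA]
    simp_rw [this]
    rw [ENNReal.tsum_mul_left, ← measure_iUnion hdisj fun i => hd (measurableSet_singleton i),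
      ← huniv, measure_univ, mul_one]
  · intro i i' hii'
    exact (hdisj hii').mono Set.inter_subset_right Set.inter_subset_right
  · exact fun i => (hζ i hA).inter (hd (measurableSet_singleton i))

theorem ae_lt_of_uniform [IsProbabilityMeasure P] {N : ℕ} (hN : 0 < N) {d : Ω → ℕ}
    (hd : Measurable d) (hu : ∀ i < N, P {ω | d ω = i} = (N : ℝ≥0∞)⁻¹) : ∀ᵐ ω ∂P, d ω < N := by
  have hm : MeasurableSet {ω | d ω < N} := hd (measurableSet_Iio (a := N))
  have hone : P {ω | d ω < N} = 1 := by
    have hpart : {ω | d ω < N} = ⋃ i ∈ Finset.range N, {ω | d ω = i} := by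
      ext ω; simp
    rw [hpart, measure_biUnion_finset]
    · rw [Finset.sum_congr rfl fun i hi => hu i (Finset.mem_range.1 hi), Finset.sum_const,
        Finset.card_range, nsmul_eq_mul]
      exact ENNReal.mul_inv_cancel (by simpa using hN.ne') (by simp)
    · intro i _ i' _ hii'
      exact Set.disjoint_left.2 fun ω (h : d ω = i) (h' : d ω = i') => hii' (h.symm.trans h')
    · exact fun i _ => hd (measurableSet_singleton i)
  exact (prob_compl_eq_zero_iff hm).2 hone

theorem measureReal_eq_le_of_uniform [IsProbabilityMeasure P] {N : ℕ} (hN : 0 < N) {d d' : Ω → ℕ}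
    (hd : Measurable d) (hu : ∀ i < N, P {ω | d ω = i} = (N : ℝ≥0∞)⁻¹)
    (hu' : ∀ i < N, P {ω | d' ω = i} = (N : ℝ≥0∞)⁻¹) (hind : IndepFun d d' P) :
    P.real {ω | d ω = d' ω} ≤ (N : ℝ)⁻¹ := by
  have h0 := ae_lt_of_uniform hN hd hu
  have hle : P {ω | d ω = d' ω} ≤ (N : ℝ≥0∞)⁻¹ := by
    calc P {ω | d ω = d' ω}
        ≤ P (⋃ i ∈ Finset.range N, (d ⁻¹' {i} ∩ d' ⁻¹' {i})) := by
          refine measure_mono_ae ?_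
          filter_upwards [h0] with ω hω (h : d ω = d' ω)
          show ω ∈ ⋃ i ∈ Finset.range N, (d ⁻¹' {i} ∩ d' ⁻¹' {i})
          simp [h.symm, hω]
      _ ≤ ∑ i ∈ Finset.range N, P (d ⁻¹' {i} ∩ d' ⁻¹' {i}) := measure_biUnion_finset_le _ _
      _ = ∑ i ∈ Finset.range N, (N : ℝ≥0∞)⁻¹ * (N : ℝ≥0∞)⁻¹ := by
          refine Finset.sum_congr rfl fun i hi => ?_
          rw [hind.measure_inter_preimage_eq_mul _ _ (measurableSet_singleton i)
            (measurableSet_singleton i)]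
          exact congrArg₂ _ (hu i (Finset.mem_range.1 hi)) (hu' i (Finset.mem_range.1 hi))
      _ = (N : ℝ≥0∞)⁻¹ := by
          rw [Finset.sum_const, Finset.card_range, nsmul_eq_mul, ← mul_assoc,
            ENNReal.mul_inv_cancel (by simpa using hN.ne') (by simp), one_mul]
  have := ENNReal.toReal_mono (by simpa using hN.ne') hle
  simpa [Measure.real] using this

/-- The birthday bound: independent uniform draws from `N` items collide with probability at most
`(number of draws)² / N`. -/
theorem measureReal_not_injective_le [IsProbabilityMeasure P] [Fintype κ] {N : ℕ} (hN : 0 < N)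
    {d : κ → Ω → ℕ} (hd : ∀ k, Measurable (d k))
    (hu : ∀ k, ∀ i < N, P {ω | d k ω = i} = (N : ℝ≥0∞)⁻¹) (hind : iIndepFun d P) :
    P.real {ω | ¬ Function.Injective fun k => d k ω} ≤ (Fintype.card κ : ℝ) ^ 2 / N := by
  classical
  have hsub : {ω | ¬ Function.Injective fun k => d k ω} ⊆
      ⋃ q ∈ (Finset.univ : Finset (κ × κ)).filter (fun q => q.1 ≠ q.2),
        {ω | d q.1 ω = d q.2 ω} := by
    intro ω hω
    have hω' : ¬ Function.Injective fun k => d k ω := hω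
    simp only [Function.Injective, not_forall] at hω'
    obtain ⟨k, k', h, hne⟩ := hω'
    simp only [Set.mem_iUnion]
    exact ⟨(k, k'), by simpa using hne, h⟩
  calc P.real {ω | ¬ Function.Injective fun k => d k ω}
      ≤ _ := (measureReal_mono hsub (measure_ne_top _ _)).trans
        (measureReal_biUnion_finset_le _ _)
    _ ≤ ∑ q ∈ (Finset.univ : Finset (κ × κ)).filter (fun q => q.1 ≠ q.2), (N : ℝ)⁻¹ := by
        refine Finset.sum_le_sum fun q hq => ?_
        exact measureReal_eq_le_of_uniform hN (hd _) (hu _) (hu _)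
          (hind.indepFun (Finset.mem_filter.1 hq).2)
    _ ≤ ∑ q : κ × κ, (N : ℝ)⁻¹ :=
        Finset.sum_le_sum_of_subset_of_nonneg (Finset.filter_subset _ _)
          fun _ _ _ => by positivity
    _ = (Fintype.card κ : ℝ) ^ 2 / N := by
        simp [div_eq_mul_inv, sq]

/-- Resampling with independent uniform draws. On the event that all draws are distinct the
selected variables are independent, so that a bounded function of them that is centred under the
product law has a mean of the order of the collision probability. -/
theorem abs_integral_select_le [IsProbabilityMeasure P] [Fintype κ]
    {ν : J → Measure E} {ζ : ℕ → J → Ω → E} (hζ : ∀ i j, Measurable (ζ i j))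
    (hind : iIndepFun (fun i ω j => ζ i j ω) P) (hlaw : ∀ i j, P.map (ζ i j) = ν j)
    {N : ℕ} (hN : 0 < N) {d : κ → Ω → ℕ} (hd : ∀ k, Measurable (d k))
    (hu : ∀ k, ∀ i < N, P {ω | d k ω = i} = (N : ℝ≥0∞)⁻¹) (hdind : iIndepFun d P)
    (hdζ : IndepFun (fun ω i j => ζ i j ω) (fun ω k => d k ω) P) (π : κ → J)
    {g : (κ → E) → ℝ} (hg : Measurable g) {C : ℝ} (hC : ∀ x, |g x| ≤ C)
    (hg0 : ∫ x, g x ∂(Measure.pi fun k => ν (π k)) = 0) :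
    |∫ ω, g (fun k => ζ (d k ω) (π k) ω) ∂P| ≤ C * ((Fintype.card κ : ℝ) ^ 2 / N) := by
  have hC0 : 0 ≤ C := by
    obtain ⟨ω⟩ := P.nonempty_of_neZero
    exact (abs_nonneg _).trans (hC fun k => ζ 0 (π k) ω)
  set X : Ω → κ → E := fun ω k => ζ (d k ω) (π k) ω with hX
  have hXm : Measurable X := measurable_pi_lambda _ fun k => measurable_select (fun i => hζ i (π k)) (hd k)
  have hint : Integrable (fun ω => g (X ω)) P :=
    Integrable.of_bound (hg.comp hXm).aestronglyMeasurable C (Eventually.of_forall fun ω => hC _)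
  set I : Set Ω := {ω | Function.Injective fun k => d k ω} with hI
  have hdm : Measurable fun ω k => d k ω := measurable_pi_lambda _ hd
  have hIU : I = ⋃ i : {i : κ → ℕ // Function.Injective i}, (fun ω k => d k ω) ⁻¹' {i.1} := by
    ext ω
    simp only [Set.mem_iUnion, Set.mem_preimage, Set.mem_singleton_iff, hI]
    exact ⟨fun h => ⟨⟨_, h⟩, rfl⟩, fun ⟨i, h⟩ => by rw [Set.mem_ofPred_eq, h]; exact i.2⟩
  have hIm : MeasurableSet I := by
    rw [hIU]
    exact MeasurableSet.iUnion fun i => hdm (measurableSet_singleton _)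
  have hI0 : ∫ ω in I, g (X ω) ∂P = 0 := by
    rw [hIU, integral_iUnion (fun i => hdm (measurableSet_singleton _))]
    · -- on the event that the draws equal `i`, the selected variables are the independent `Y`
      rw [← tsum_zero (β := {i : κ → ℕ // Function.Injective i})]
      refine tsum_congr fun i => ?_
      have him : MeasurableSet ((fun ω k => d k ω) ⁻¹' {i.1}) := hdm (measurableSet_singleton _)
      set Y : Ω → κ → E := fun ω k => ζ (i.1 k) (π k) ω with hY
      have hYm : Measurable Y := measurable_pi_lambda _ fun k => hζ _ _
      have hYlaw : P.map Y = Measure.pi fun k => ν (π k) := by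
        have h1 : iIndepFun (fun k ω => ζ (i.1 k) (π k) ω) P :=
          (hind.precomp i.2).comp (fun k (x : J → E) => x (π k)) fun k => measurable_pi_apply _
        rw [hY, h1.map_fun_eq_pi_map fun k => (hζ _ _).aemeasurable]
        simp_rw [hlaw]
      have hcongr : ∫ ω in (fun ω k => d k ω) ⁻¹' {i.1}, g (X ω) ∂P
          = ∫ ω in (fun ω k => d k ω) ⁻¹' {i.1}, g (Y ω) ∂P := by
        refine setIntegral_congr_fun him fun ω (hω : (fun k => d k ω) = i.1) => ?_
        show g (fun k => ζ (d k ω) (π k) ω) = g fun k => ζ (i.1 k) (π k) ω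
        rw [← hω]
      have hmul : ∀ ω, Set.indicator ((fun ω k => d k ω) ⁻¹' {i.1}) (fun ω => g (Y ω)) ω
          = g (Y ω) * Set.indicator {i.1} (fun _ => (1 : ℝ)) (fun k => d k ω) := by
        intro ω
        by_cases h : (fun k => d k ω) = i.1 <;> simp [Set.indicator, h]
      rw [hcongr, ← integral_indicator him, integral_congr_ae (Eventually.of_forall hmul)]
      have hI : IndepFun (fun ω => g (Y ω))
          (fun ω => Set.indicator {i.1} (fun _ => (1 : ℝ)) (fun k => d k ω)) P :=
        hdζ.comp (φ := fun z : ℕ → J → E => g fun k => z (i.1 k) (π k))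
          (ψ := Set.indicator {i.1} fun _ => (1 : ℝ))
          (hg.comp (measurable_pi_lambda _ fun k =>
            (measurable_pi_apply _).comp (measurable_pi_apply _)))
          (measurable_const.indicator (measurableSet_singleton _))
      rw [hI.integral_fun_mul_eq_mul_integral (hg.comp hYm).aestronglyMeasurable
        (((measurable_const.indicator (measurableSet_singleton _)).comp
          hdm).aestronglyMeasurable)]
      have h0 : ∫ ω, g (Y ω) ∂P = 0 := by
        rw [← hg0, ← hYlaw, integral_map hYm.aemeasurable hg.aestronglyMeasurable]
      rw [h0, zero_mul]
    · intro i i' hii'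
      exact Disjoint.preimage _ (by simpa [Subtype.ext_iff] using hii')
    · exact hint.integrableOn
  have hsplit := integral_add_compl hIm hint
  rw [hI0, zero_add] at hsplit
  rw [← hsplit]
  calc |∫ ω in Iᶜ, g (X ω) ∂P| ≤ C * P.real Iᶜ := by
        simpa only [Real.norm_eq_abs] using norm_setIntegral_le_of_norm_le_const (μ := P)
          (f := fun ω => g (X ω)) (measure_lt_top P Iᶜ) fun ω _ => hC _
    _ ≤ _ := by
        gcongr
        exact measureReal_not_injective_le hN hd hu hdind

/-- A resampling scheme: rows `(ζ i j)_j`, independent across `i`, whose `j`-th entry has law `ν j`;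
in the sample of size `N`, independent uniform draws of the row that supplies the `j`-th entry in
replication `b`. -/
structure Resampling (P : Measure Ω) (ν : J → Measure E) (ζ : ℕ → J → Ω → E)
    (draw : ℕ → ℕ → J → Ω → ℕ) : Prop where
  measurable_row : ∀ i j, Measurable (ζ i j)
  indep_row : iIndepFun (fun i ω j => ζ i j ω) P
  law : ∀ i j, P.map (ζ i j) = ν j
  measurable_draw : ∀ N b j, Measurable (draw N b j)
  uniform : ∀ N b j, ∀ i < N, P {ω | draw N b j ω = i} = (N : ℝ≥0∞)⁻¹
  indep_draw : ∀ N, 0 < N → iIndepFun (fun bj : ℕ × J => draw N bj.1 bj.2) P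
  indep_row_draw : ∀ N, 0 < N → IndepFun (fun ω i j => ζ i j ω)
    (fun ω (bj : ℕ × J) => draw N bj.1 bj.2 ω) P

/-- The `b`-th resampled vector. -/
def resample (ζ : ℕ → J → Ω → E) (draw : ℕ → ℕ → J → Ω → ℕ) (N b : ℕ) (ω : Ω) : J → E :=
  fun j => ζ (draw N b j ω) j ω

variable {ν : J → Measure E} {ζ : ℕ → J → Ω → E} {draw : ℕ → ℕ → J → Ω → ℕ}

theorem Resampling.measurable_resample (h : Resampling P ν ζ draw) (N b : ℕ) :
    Measurable (resample ζ draw N b) :=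
  measurable_pi_lambda _ fun j =>
    measurable_select (fun i => h.measurable_row i j) (h.measurable_draw N b j)

theorem Resampling.map_resample_apply [IsProbabilityMeasure P] (h : Resampling P ν ζ draw) {N : ℕ}
    (hN : 0 < N) (b : ℕ) (j : J) : P.map (fun ω => resample ζ draw N b ω j) = ν j :=
  map_select (fun i => h.measurable_row i j) (fun i => h.law i j) (h.measurable_draw N b j)
    fun i => (h.indep_row_draw N hN).comp (φ := fun z : ℕ → J → E => z i j)
      (ψ := fun d : ℕ × J → ℕ => d (b, j))
      ((measurable_pi_apply _).comp (measurable_pi_apply _)) (measurable_pi_apply _)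

/-- Two replications are nearly uncorrelated. -/
theorem Resampling.abs_integral_mul_le [IsProbabilityMeasure P] [Fintype J]
    [∀ j, IsProbabilityMeasure (ν j)]
    (h : Resampling P ν ζ draw) {N : ℕ} (hN : 0 < N) {b b' : ℕ} (hb : b ≠ b')
    {f : (J → E) → ℝ} (hf : Measurable f) {C : ℝ} (hC : ∀ x, |f x| ≤ C)
    (hf0 : ∫ x, f x ∂(Measure.pi ν) = 0) :
    |∫ ω, f (resample ζ draw N b ω) * f (resample ζ draw N b' ω) ∂P|
      ≤ C ^ 2 * ((2 * Fintype.card J : ℝ) ^ 2 / N) := by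
  -- the draws of the two replications form one family of `2 |J|` independent draws
  let idx : J ⊕ J → ℕ × J := Sum.elim (fun j => (b, j)) (fun j => (b', j))
  have hidx : Function.Injective idx := by
    rintro (j | j) (j' | j') hjj' <;> simp_all [idx]
  have hfl : Measurable fun x : J ⊕ J → E => f fun j => x (Sum.inl j) :=
    hf.comp (measurable_pi_lambda _ fun j => measurable_pi_apply _)
  have hfr : Measurable fun x : J ⊕ J → E => f fun j => x (Sum.inr j) :=
    hf.comp (measurable_pi_lambda _ fun j => measurable_pi_apply _)
  have key := abs_integral_select_le (κ := J ⊕ J) h.measurable_row h.indep_row h.law hN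
    (d := fun k => draw N (idx k).1 (idx k).2) (fun k => h.measurable_draw _ _ _)
    (fun k => h.uniform _ _ _) ((h.indep_draw N hN).precomp hidx)
    ((h.indep_row_draw N hN).comp (φ := id)
      (ψ := fun (d : ℕ × J → ℕ) (k : J ⊕ J) => d (idx k)) measurable_id
      (measurable_pi_lambda _ fun k => measurable_pi_apply _))
    (fun k => (idx k).2)
    (g := fun x => f (fun j => x (Sum.inl j)) * f (fun j => x (Sum.inr j)))
    (hfl.mul hfr) (C := C ^ 2)
    (fun x => by
      rw [abs_mul, sq]
      exact mul_le_mul (hC _) (hC _) (abs_nonneg _) ((abs_nonneg _).trans (hC fun j => x (Sum.inl j))))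
    (by
      have hmp := measurePreserving_sumPiEquivProdPi (X := fun _ : J ⊕ J => E)
        (fun k => ν (idx k).2)
      have := hmp.integral_comp' (g := fun q : (J → E) × (J → E) => f q.1 * f q.2)
      refine Eq.trans this ?_
      refine (integral_prod_mul (μ := Measure.pi ν) (ν := Measure.pi ν) f f).trans ?_
      rw [hf0, zero_mul])
  have hcard : (Fintype.card (J ⊕ J) : ℝ) = 2 * Fintype.card J := by
    rw [Fintype.card_sum]; push_cast; ring
  rw [hcard] at key
  exact key

/-- The expansion of the square has `B` diagonal terms, bounded by `C²`, and fewer than `B²`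
off-diagonal ones, each of the order of the collision probability. -/
theorem Resampling.integral_average_sq_le [IsProbabilityMeasure P] [Fintype J]
    [∀ j, IsProbabilityMeasure (ν j)]
    (h : Resampling P ν ζ draw) {N B : ℕ} (hN : 0 < N) (hB : 0 < B)
    {f : (J → E) → ℝ} (hf : Measurable f) {C : ℝ} (hC : ∀ x, |f x| ≤ C)
    (hf0 : ∫ x, f x ∂(Measure.pi ν) = 0) :
    ∫ ω, ((∑ b ∈ Finset.range B, f (resample ζ draw N b ω)) / B) ^ 2 ∂P
      ≤ C ^ 2 * ((B : ℝ)⁻¹ + (2 * Fintype.card J : ℝ) ^ 2 / N) := by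
  have hm : ∀ b, Measurable fun ω => f (resample ζ draw N b ω) :=
    fun b => hf.comp (h.measurable_resample N b)
  have hbound : ∀ b b' ω, |f (resample ζ draw N b ω) * f (resample ζ draw N b' ω)| ≤ C ^ 2 := by
    intro b b' ω
    rw [abs_mul, sq]
    exact mul_le_mul (hC _) (hC _) (abs_nonneg _) ((abs_nonneg _).trans (hC (resample ζ draw N b ω)))
  have hint : ∀ b b', Integrable
      (fun ω => f (resample ζ draw N b ω) * f (resample ζ draw N b' ω)) P := fun b b' =>
    Integrable.of_bound ((hm b).mul (hm b')).aestronglyMeasurable (C ^ 2)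
      (Eventually.of_forall fun ω => hbound b b' ω)
  have hterm : ∀ b b', ∫ ω, f (resample ζ draw N b ω) * f (resample ζ draw N b' ω) ∂P
      ≤ (if b = b' then C ^ 2 else 0) + C ^ 2 * ((2 * Fintype.card J : ℝ) ^ 2 / N) := by
    intro b b'
    by_cases hb : b = b'
    · rw [if_pos hb]
      have h1 : ∫ ω, f (resample ζ draw N b ω) * f (resample ζ draw N b' ω) ∂P
          ≤ ∫ _, C ^ 2 ∂P :=
        integral_mono (hint b b') (integrable_const _) fun ω => (le_abs_self _).trans (hbound b b' ω)
      have h2 : 0 ≤ C ^ 2 * ((2 * Fintype.card J : ℝ) ^ 2 / N) := by positivity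
      simp only [integral_const, probReal_univ, one_smul] at h1
      linarith
    · rw [if_neg hb, zero_add]
      exact (le_abs_self _).trans (h.abs_integral_mul_le hN hb hf hC hf0)
  have hB' : (B : ℝ) ≠ 0 := by exact_mod_cast hB.ne'
  have hexp : ∀ ω, ((∑ b ∈ Finset.range B, f (resample ζ draw N b ω)) / B) ^ 2
      = (∑ b ∈ Finset.range B, ∑ b' ∈ Finset.range B,
          f (resample ζ draw N b ω) * f (resample ζ draw N b' ω)) / (B : ℝ) ^ 2 := by
    intro ω
    rw [div_pow, sq (∑ b ∈ Finset.range B, _), Finset.sum_mul_sum]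
  simp_rw [hexp]
  rw [integral_div, integral_finsetSum _ fun b _ => integrable_finsetSum _ fun b' _ => hint b b',
    div_le_iff₀ (by positivity)]
  calc ∑ b ∈ Finset.range B, ∫ ω, ∑ b' ∈ Finset.range B,
        f (resample ζ draw N b ω) * f (resample ζ draw N b' ω) ∂P
      ≤ ∑ b ∈ Finset.range B, ∑ b' ∈ Finset.range B,
        ((if b = b' then C ^ 2 else 0) + C ^ 2 * ((2 * Fintype.card J : ℝ) ^ 2 / N)) := by
        refine Finset.sum_le_sum fun b _ => ?_
        rw [integral_finsetSum _ fun b' _ => hint b b']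
        exact Finset.sum_le_sum fun b' _ => hterm b b'
    _ = B * C ^ 2 + B * B * (C ^ 2 * ((2 * Fintype.card J : ℝ) ^ 2 / N)) := by
        simp only [Finset.sum_add_distrib, Finset.sum_ite_eq, Finset.sum_const, Finset.card_range,
          nsmul_eq_mul]
        rw [Finset.sum_congr rfl fun b hb => if_pos hb, Finset.sum_const, Finset.card_range,
          nsmul_eq_mul]
        ring
    _ = C ^ 2 * ((B : ℝ)⁻¹ + (2 * Fintype.card J : ℝ) ^ 2 / N) * (B : ℝ) ^ 2 := by
        field_simp

theorem eventually_pos_prod : ∀ᶠ n : ℕ × ℕ in atTop ×ˢ atTop, 0 < n.1 ∧ 0 < n.2 :=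
  (eventually_gt_atTop 0).prod_mk (eventually_gt_atTop 0)

/-- The weak law of large numbers for resampled vectors, bounded case. -/
theorem Resampling.tendsto_average_of_bounded [IsProbabilityMeasure P] [Fintype J]
    [∀ j, IsProbabilityMeasure (ν j)] (h : Resampling P ν ζ draw)
    {f : (J → E) → ℝ} (hf : Measurable f) {C : ℝ} (hC : ∀ x, |f x| ≤ C) :
    Tendsto (fun p : (ℕ × ℕ) × Ω =>
        (∑ b ∈ Finset.range p.1.2, f (resample ζ draw p.1.1 b p.2)) / p.1.2)
      (inProb P (atTop ×ˢ atTop)) (𝓝 (∫ x, f x ∂(Measure.pi ν))) := by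
  set q := ∫ x, f x ∂(Measure.pi ν) with hq
  have hfi : Integrable f (Measure.pi ν) :=
    Integrable.of_bound hf.aestronglyMeasurable C (Eventually.of_forall fun x => hC x)
  set g : (J → E) → ℝ := fun x => f x - q with hg
  have hgm : Measurable g := hf.sub_const q
  have hgC : ∀ x, |g x| ≤ C + |q| := fun x => (abs_sub _ _).trans (by gcongr; exact hC x)
  have hg0 : ∫ x, g x ∂(Measure.pi ν) = 0 := by
    rw [hg, integral_sub hfi (integrable_const _)]; simp [← hq]
  have hgl : Tendsto (fun p : (ℕ × ℕ) × Ω =>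
        (∑ b ∈ Finset.range p.1.2, g (resample ζ draw p.1.1 b p.2)) / p.1.2)
      (inProb P (atTop ×ˢ atTop)) (𝓝 0) := by
    refine tendsto_inProb_of_integral_sq (f := fun (n : ℕ × ℕ) ω =>
        (∑ b ∈ Finset.range n.2, g (resample ζ draw n.1 b ω)) / n.2) (fun n => ?_) ?_
    · have hmem : MemLp (fun ω => ∑ b ∈ Finset.range n.2, g (resample ζ draw n.1 b ω)) 2 P :=
        memLp_finsetSum _ fun b _ => MemLp.of_bound
          (hgm.comp (h.measurable_resample n.1 b)).aestronglyMeasurable (C + |q|)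
          (Eventually.of_forall fun ω => hgC _)
      simpa only [div_eq_inv_mul] using hmem.const_mul ((n.2 : ℝ)⁻¹)
    · have h1 : Tendsto (fun n : ℕ × ℕ => (C + |q|) ^ 2 *
          ((n.2 : ℝ)⁻¹ + (2 * Fintype.card J : ℝ) ^ 2 / n.1)) (atTop ×ˢ atTop) (𝓝 0) := by
        have ha : Tendsto (fun n : ℕ × ℕ => (n.2 : ℝ)⁻¹) (atTop ×ˢ atTop) (𝓝 0) :=
          (tendsto_inv_atTop_nhds_zero_nat (𝕜 := ℝ)).comp tendsto_snd
        have hb : Tendsto (fun n : ℕ × ℕ => (2 * Fintype.card J : ℝ) ^ 2 / n.1)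
            (atTop ×ˢ atTop) (𝓝 0) :=
          (tendsto_const_div_atTop_nhds_zero_nat _).comp tendsto_fst
        simpa using (ha.add hb).const_mul ((C + |q|) ^ 2)
      refine tendsto_of_tendsto_of_tendsto_of_le_of_le' tendsto_const_nhds h1
        (Eventually.of_forall fun n => integral_nonneg fun ω => sq_nonneg _) ?_
      filter_upwards [eventually_pos_prod] with n hn
      exact h.integral_average_sq_le hn.1 hn.2 hgm hgC hg0
  have hadd := hgl.add_const q
  rw [zero_add] at hadd
  refine hadd.congr' ?_
  filter_upwards [eventually_inProb_of_eventually eventually_pos_prod] with p hp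
  have hB : (p.1.2 : ℝ) ≠ 0 := by exact_mod_cast hp.2.ne'
  simp only [hg, Finset.sum_sub_distrib, Finset.sum_const, Finset.card_range, nsmul_eq_mul]
  field_simp
  ring

end Resampling

section QuadraticGrowth

variable {Ω J : Type*} {K : ℕ} [MeasurableSpace Ω] {P : Measure Ω} [Fintype J]
  {ν : J → Measure (Fin K → ℝ)}

/-- The norm is the maximum of the norms of the entries; its positivity excludes an empty `J`. -/
theorem exists_norm_apply_eq {x : J → Fin K → ℝ} (hx : 0 < ‖x‖) : ∃ j, ‖x j‖ = ‖x‖ := by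
  by_contra! hc
  exact lt_irrefl _ ((pi_norm_lt_iff hx).2 fun j => (norm_le_pi_norm x j).lt_of_ne (hc j))

theorem integrable_pi_of_growth [∀ j, IsProbabilityMeasure (ν j)]
    (hν : ∀ j, Integrable (fun y => (1 + ‖y‖) ^ 2) (ν j))
    {f : (J → Fin K → ℝ) → ℝ} (hf : Measurable f) {C : ℝ} (hC : ∀ x, |f x| ≤ C * (1 + ‖x‖) ^ 2) :
    Integrable f (Measure.pi ν) := by
  have hsum : Integrable (fun x : J → Fin K → ℝ => 1 + ∑ j, (1 + ‖x j‖) ^ 2) (Measure.pi ν) :=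
    (integrable_const _).add (integrable_finsetSum _ fun j _ =>
      (measurePreserving_eval ν j).integrable_comp_of_integrable (hν j))
  have hdom : Integrable (fun x : J → Fin K → ℝ => (1 + ‖x‖) ^ 2) (Measure.pi ν) := by
    refine hsum.mono' (by fun_prop) (Eventually.of_forall fun x => ?_)
    rw [Real.norm_of_nonneg (by positivity)]
    rcases (norm_nonneg x).eq_or_lt with h0 | hpos
    · rw [← h0]
      have : 0 ≤ ∑ j, (1 + ‖x j‖) ^ 2 := Finset.sum_nonneg fun j _ => by positivity
      linarith
    · obtain ⟨j, hj⟩ := exists_norm_apply_eq hpos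
      have := Finset.single_le_sum (f := fun j => (1 + ‖x j‖) ^ 2) (fun j _ => by positivity)
        (Finset.mem_univ j)
      simp only [hj] at this
      linarith
  exact (hdom.const_mul C).mono' hf.aestronglyMeasurable (Eventually.of_forall hC)

/-- The weak law of large numbers for resampled vectors and functions of quadratic growth. The
truncation error is controlled by the marginal laws of the resampled vectors, which are exact. -/
theorem Resampling.tendsto_average [IsProbabilityMeasure P] [∀ j, IsProbabilityMeasure (ν j)]
    {ζ : ℕ → J → Ω → Fin K → ℝ} {draw : ℕ → ℕ → J → Ω → ℕ} (h : Resampling P ν ζ draw)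
    (hν : ∀ j, Integrable (fun y => (1 + ‖y‖) ^ 2) (ν j))
    {f : (J → Fin K → ℝ) → ℝ} (hf : Measurable f) {C : ℝ} (hC : ∀ x, |f x| ≤ C * (1 + ‖x‖) ^ 2) :
    Tendsto (fun p : (ℕ × ℕ) × Ω =>
        (∑ b ∈ Finset.range p.1.2, f (resample ζ draw p.1.1 b p.2)) / p.1.2)
      (inProb P (atTop ×ˢ atTop)) (𝓝 (∫ x, f x ∂(Measure.pi ν))) := by
  have hC0 : 0 ≤ C := by
    have h0 := (abs_nonneg _).trans (hC 0)
    simpa using h0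
  have hfi := integrable_pi_of_growth hν hf hC
  -- `F k` is `f` truncated to `‖x‖ ≤ k`; the error is at most the sum of the tails of the entries,
  -- since a vector of norm above `k` has an entry of that norm
  let F : ℕ → (J → Fin K → ℝ) → ℝ := fun k => {x | ‖x‖ ≤ k}.indicator f
  let tail : ℕ → (Fin K → ℝ) → ℝ := fun k => {y | ¬ ‖y‖ ≤ k}.indicator fun y => (1 + ‖y‖) ^ 2
  have hms : ∀ k : ℕ, MeasurableSet {x : J → Fin K → ℝ | ‖x‖ ≤ k} := fun k =>
    measurableSet_le measurable_norm measurable_const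
  have hmt : ∀ k : ℕ, MeasurableSet {y : Fin K → ℝ | ¬ ‖y‖ ≤ k} := fun k =>
    (measurableSet_le measurable_norm measurable_const).compl
  have hFm : ∀ k, Measurable (F k) := fun k => hf.indicator (hms k)
  have htm : ∀ k, Measurable (tail k) := fun k => Measurable.indicator (by fun_prop) (hmt k)
  have ht0 : ∀ k y, 0 ≤ tail k y := fun k y => Set.indicator_nonneg (fun y _ => by positivity) y
  have hti : ∀ k j, Integrable (tail k) (ν j) := fun k j => (hν j).indicator (hmt k)
  have hFb : ∀ k x, |F k x| ≤ C * (1 + k) ^ 2 := by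
    intro k x
    by_cases hx : ‖x‖ ≤ k
    · simp only [F, Set.indicator_of_mem (show x ∈ {x : J → Fin K → ℝ | ‖x‖ ≤ k} from hx)]
      exact (hC x).trans (by gcongr)
    · simp only [F, Set.indicator_of_notMem (show x ∉ {x : J → Fin K → ℝ | ‖x‖ ≤ k} from hx)]
      simp only [abs_zero]; positivity
  have hdiff : ∀ k x, |f x - F k x| ≤ C * ∑ j, tail k (x j) := by
    intro k x
    have hs0 : 0 ≤ ∑ j, tail k (x j) := Finset.sum_nonneg fun j _ => ht0 k _
    by_cases hx : ‖x‖ ≤ k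
    · simp only [F, Set.indicator_of_mem (show x ∈ {x : J → Fin K → ℝ | ‖x‖ ≤ k} from hx)]
      simp only [sub_self, abs_zero]; positivity
    · simp only [F, Set.indicator_of_notMem (show x ∉ {x : J → Fin K → ℝ | ‖x‖ ≤ k} from hx),
        sub_zero]
      refine (hC x).trans ?_
      obtain ⟨j, hj⟩ := exists_norm_apply_eq (lt_of_le_of_lt (Nat.cast_nonneg k) (not_le.1 hx))
      have h1 := Finset.single_le_sum (f := fun j => tail k (x j)) (fun j _ => ht0 k _)
        (Finset.mem_univ j)
      have h2 : tail k (x j) = (1 + ‖x‖) ^ 2 := by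
        simp only [tail]
        rw [Set.indicator_of_mem (show x j ∈ {y : Fin K → ℝ | ¬ ‖y‖ ≤ k} by
          show ¬ ‖x j‖ ≤ k
          rwa [hj]), hj]
      rw [← h2]
      gcongr
  refine tendsto_inProb_of_approx
    (f := fun (n : ℕ × ℕ) ω => (∑ b ∈ Finset.range n.2, f (resample ζ draw n.1 b ω)) / n.2)
    (fk := fun k (n : ℕ × ℕ) ω => (∑ b ∈ Finset.range n.2, F k (resample ζ draw n.1 b ω)) / n.2)
    (g := fun k (n : ℕ × ℕ) ω =>
      (∑ b ∈ Finset.range n.2, C * ∑ j, tail k (resample ζ draw n.1 b ω j)) / n.2)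
    (ck := fun k => ∫ x, F k x ∂(Measure.pi ν))
    (ε := fun k => ENNReal.ofReal (C * ∑ j, ∫ y, tail k y ∂(ν j))) ?_ ?_ ?_ ?_ ?_ ?_
  · intro k n ω
    rw [← sub_div, ← Finset.sum_sub_distrib, abs_div, Nat.abs_cast]
    gcongr
    exact (Finset.abs_sum_le_sum_abs _ _).trans (Finset.sum_le_sum fun b _ => hdiff k _)
  · intro k n
    refine Measurable.aemeasurable (Measurable.div_const (Finset.measurable_sum _ fun b _ =>
      Measurable.const_mul (Finset.measurable_sum _ fun j _ => ?_) _) _)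
    exact (htm k).comp ((measurable_pi_apply j).comp (h.measurable_resample n.1 b))
  · intro k
    filter_upwards [eventually_pos_prod] with n hn
    have hB : (n.2 : ℝ) ≠ 0 := by exact_mod_cast hn.2.ne'
    have hmj : ∀ b j, Measurable fun ω => resample ζ draw n.1 b ω j := fun b j =>
      (measurable_pi_apply j).comp (h.measurable_resample n.1 b)
    have hi1 : ∀ b j, Integrable (fun ω => tail k (resample ζ draw n.1 b ω j)) P := by
      intro b j
      have h1 := hti k j
      rw [← h.map_resample_apply hn.1 b j] at h1
      exact h1.comp_measurable (hmj b j)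
    have he1 : ∀ b j, ∫ ω, tail k (resample ζ draw n.1 b ω j) ∂P = ∫ y, tail k y ∂(ν j) := by
      intro b j
      rw [← h.map_resample_apply hn.1 b j,
        integral_map (hmj b j).aemeasurable (htm k).aestronglyMeasurable]
    have hi2 : ∀ b, Integrable (fun ω => C * ∑ j, tail k (resample ζ draw n.1 b ω j)) P :=
      fun b => (integrable_finsetSum _ fun j _ => hi1 b j).const_mul C
    rw [← ofReal_integral_eq_lintegral_ofReal
      ((integrable_finsetSum _ fun b _ => hi2 b).div_const _)
      (Eventually.of_forall fun ω => div_nonneg (Finset.sum_nonneg fun b _ =>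
        mul_nonneg hC0 (Finset.sum_nonneg fun j _ => ht0 k _)) (Nat.cast_nonneg _))]
    refine ENNReal.ofReal_le_ofReal (le_of_eq ?_)
    rw [integral_div, integral_finsetSum _ fun b _ => hi2 b]
    simp_rw [integral_const_mul, integral_finsetSum _ fun j _ => hi1 _ j, he1]
    rw [Finset.sum_const, Finset.card_range, nsmul_eq_mul]
    field_simp
  · have h1 : ∀ j, Tendsto (fun k => ∫ y, tail k y ∂(ν j)) atTop (𝓝 0) := by
      intro j
      have h2 := tendsto_integral_of_dominated_convergence (μ := ν j) (F := tail)
        (f := fun _ => (0 : ℝ)) (fun y => (1 + ‖y‖) ^ 2)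
        (fun k => (htm k).aestronglyMeasurable) (hν j)
        (fun k => Eventually.of_forall fun y => by
          rw [Real.norm_of_nonneg (ht0 k y)]
          exact Set.indicator_le_self' (fun _ _ => by positivity) y)
        (Eventually.of_forall fun y => by
          obtain ⟨m, hm⟩ := exists_nat_ge ‖y‖
          refine tendsto_const_nhds.congr' ?_
          filter_upwards [eventually_ge_atTop m] with k hk
          have : ‖y‖ ≤ k := hm.trans (by exact_mod_cast hk)
          exact (Set.indicator_of_notMem (fun h : ¬ ‖y‖ ≤ k => h this) _).symm)
      simpa using h2
    have h3 := ENNReal.tendsto_ofReal ((tendsto_finsetSum Finset.univ fun j _ => h1 j).const_mul C)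
    simpa using h3
  · refine tendsto_integral_of_dominated_convergence (fun x => |f x|)
      (fun k => (hFm k).aestronglyMeasurable) hfi.abs (fun k => Eventually.of_forall fun x => ?_)
      (Eventually.of_forall fun x => ?_)
    · exact norm_indicator_le_norm_self f x
    · obtain ⟨m, hm⟩ := exists_nat_ge ‖x‖
      refine tendsto_const_nhds.congr' ?_
      filter_upwards [eventually_ge_atTop m] with k hk
      have : ‖x‖ ≤ k := hm.trans (by exact_mod_cast hk)
      exact (Set.indicator_of_mem (show x ∈ {x : J → Fin K → ℝ | ‖x‖ ≤ k} from this) f).symm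
  · exact fun k => h.tendsto_average_of_bounded (hFm k) (hFb k)

end QuadraticGrowth

end FewTreatedDID

/-! ### Spectral norm and rescaling by estimated matrices -/

namespace FewTreatedDID

section SpectralNorm

variable {K : ℕ}

theorem specNorm_nonneg (M : Matrix (Fin K) (Fin K) ℝ) : 0 ≤ specNorm M := norm_nonneg _

theorem norm_toLp_mulVec_le (M : Matrix (Fin K) (Fin K) ℝ) (x : Fin K → ℝ) :
    ‖WithLp.toLp 2 (M *ᵥ x)‖ ≤ specNorm M * ‖WithLp.toLp 2 x‖ := by
  have h := (Matrix.toEuclideanCLM (n := Fin K) (𝕜 := ℝ) M).le_opNorm (WithLp.toLp 2 x)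
  rwa [Matrix.toEuclideanCLM_toLp] at h

theorem specNorm_add_le (M M' : Matrix (Fin K) (Fin K) ℝ) :
    specNorm (M + M') ≤ specNorm M + specNorm M' := by
  unfold specNorm
  rw [map_add]
  exact norm_add_le _ _

theorem specNorm_sub_comm (M M' : Matrix (Fin K) (Fin K) ℝ) :
    specNorm (M - M') = specNorm (M' - M) := by
  unfold specNorm
  rw [map_sub, map_sub, norm_sub_rev]

theorem norm_le_norm_toLp (x : Fin K → ℝ) : ‖x‖ ≤ ‖WithLp.toLp 2 x‖ :=
  (pi_norm_le_iff_of_nonneg (norm_nonneg _)).2 fun i => PiLp.norm_apply_le (WithLp.toLp 2 x) i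

theorem norm_toLp_le (x : Fin K → ℝ) : ‖WithLp.toLp 2 x‖ ≤ √K * ‖x‖ := by
  rw [EuclideanSpace.norm_eq]
  refine Real.sqrt_le_iff.2 ⟨by positivity, ?_⟩
  rw [mul_pow, Real.sq_sqrt (Nat.cast_nonneg K)]
  calc ∑ i, ‖x i‖ ^ 2 ≤ ∑ _ : Fin K, ‖x‖ ^ 2 := by
        gcongr with i
        exact norm_le_pi_norm x i
    _ = K * ‖x‖ ^ 2 := by simp

theorem norm_mulVec_le (M : Matrix (Fin K) (Fin K) ℝ) (x : Fin K → ℝ) :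
    ‖M *ᵥ x‖ ≤ √K * specNorm M * ‖x‖ := by
  calc ‖M *ᵥ x‖ ≤ specNorm M * ‖WithLp.toLp 2 x‖ :=
        (norm_le_norm_toLp _).trans (norm_toLp_mulVec_le M x)
    _ ≤ specNorm M * (√K * ‖x‖) := by
        gcongr
        · exact specNorm_nonneg M
        · exact norm_toLp_le x
    _ = _ := by ring

theorem mul_norm_toLp_le_of_le_lambdaMin {M : Matrix (Fin K) (Fin K) ℝ} (hM : M.IsHermitian)
    {c : ℝ} (hc : c ≤ lambdaMin M) (x : Fin K → ℝ) :
    c * ‖WithLp.toLp 2 x‖ ≤ ‖WithLp.toLp 2 (M *ᵥ x)‖ := by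
  have hpsd : (M - algebraMap ℝ _ c).PosSemidef := by
    refine Matrix.posSemidef_iff_isHermitian_and_spectrum_nonneg.2 ⟨?_, ?_⟩
    · refine hM.sub ?_
      rw [Algebra.algebraMap_eq_smul_one]
      simp [Matrix.IsHermitian]
    · rw [← spectrum.sub_singleton_eq]
      rintro _ ⟨a, ha, b, rfl, rfl⟩
      have hfin : (spectrum ℝ M).Finite := by
        rw [hM.spectrum_real_eq_range_eigenvalues]
        exact Set.finite_range _
      have : b ≤ a := hc.trans (csInf_le hfin.bddBelow ha)
      show 0 ≤ a - b
      linarith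
  have h0 : 0 ≤ x ⬝ᵥ ((M - algebraMap ℝ _ c) *ᵥ x) := by
    have := hpsd.dotProduct_mulVec_nonneg x
    simpa using this
  have h1 : x ⬝ᵥ (M *ᵥ x) ≤ ‖WithLp.toLp 2 (M *ᵥ x)‖ * ‖WithLp.toLp 2 x‖ := by
    have := real_inner_le_norm (WithLp.toLp 2 (M *ᵥ x)) (WithLp.toLp 2 x)
    rw [EuclideanSpace.inner_toLp_toLp] at this
    simpa using this
  have h2 : x ⬝ᵥ x = ‖WithLp.toLp 2 x‖ ^ 2 := by
    have := real_inner_self_eq_norm_sq (WithLp.toLp 2 x)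
    rw [EuclideanSpace.inner_toLp_toLp] at this
    simpa using this
  have h3 : x ⬝ᵥ ((M - algebraMap ℝ _ c) *ᵥ x) = x ⬝ᵥ (M *ᵥ x) - c * (x ⬝ᵥ x) := by
    rw [Matrix.sub_mulVec, dotProduct_sub, Algebra.algebraMap_eq_smul_one, Matrix.smul_mulVec,
      Matrix.one_mulVec, dotProduct_smul, smul_eq_mul]
  rcases (norm_nonneg (WithLp.toLp 2 x)).eq_or_lt with h | h
  · rw [← h]; simp
  · refine le_of_mul_le_mul_right ?_ h
    rw [h3, h2] at h0
    have h4 : c * ‖WithLp.toLp 2 x‖ * ‖WithLp.toLp 2 x‖ = c * ‖WithLp.toLp 2 x‖ ^ 2 := by ring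
    linarith

/-- A matrix that is bounded below is injective, hence invertible. -/
theorem isUnit_det_of_bounded_below {M : Matrix (Fin K) (Fin K) ℝ} {c : ℝ} (hc : 0 < c)
    (h : ∀ x : Fin K → ℝ, c * ‖WithLp.toLp 2 x‖ ≤ ‖WithLp.toLp 2 (M *ᵥ x)‖) : IsUnit M.det := by
  rw [← Matrix.isUnit_iff_isUnit_det, ← Matrix.mulVec_injective_iff_isUnit]
  intro x y hxy
  have h1 := h (x - y)
  rw [Matrix.mulVec_sub, hxy, sub_self, WithLp.toLp_zero, norm_zero] at h1
  have h2 : ‖WithLp.toLp 2 (x - y)‖ ≤ 0 := by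
    by_contra! hpos
    have := mul_pos hc hpos
    linarith
  have h3 := (norm_le_norm_toLp (x - y)).trans h2
  exact sub_eq_zero.1 (norm_le_zero_iff.1 h3)

/-- The perturbation estimate behind the bootstrap: rescaling `H_i x - m` with estimated matrices
`H_i'` and `H_j'` gives `H_j x` up to an error that is linear in the estimation error `ε` and in
the estimation error `m` of the centring. -/
theorem norm_rescale_sub_le {Hi Hi' Hj Hj' : Matrix (Fin K) (Fin K) ℝ} {c h ε : ℝ} (hc : 0 < c)
    (hherm : Hi.IsHermitian) (hmin : c ≤ lambdaMin Hi) (hHi : specNorm Hi ≤ h)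
    (hHj : specNorm Hj ≤ h) (hi : specNorm (Hi' - Hi) ≤ ε) (hj : specNorm (Hj' - Hj) ≤ ε)
    (hε : ε ≤ c / 2) (x m : Fin K → ℝ) :
    ‖Hj' *ᵥ (Hi'⁻¹ *ᵥ (Hi *ᵥ x - m)) - Hj *ᵥ x‖
      ≤ √K * (4 * h / c * ε * ‖x‖ + (h + ε) * (2 / c) * ‖m‖) := by
  have hε0 : 0 ≤ ε := (specNorm_nonneg _).trans hi
  have hh0 : 0 ≤ h := (specNorm_nonneg _).trans hHi
  have hbelow : ∀ y : Fin K → ℝ, c / 2 * ‖WithLp.toLp 2 y‖ ≤ ‖WithLp.toLp 2 (Hi' *ᵥ y)‖ := by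
    intro y
    have h1 := mul_norm_toLp_le_of_le_lambdaMin hherm hmin y
    have h2 : ‖WithLp.toLp 2 (Hi *ᵥ y)‖
        ≤ ‖WithLp.toLp 2 (Hi' *ᵥ y)‖ + ε * ‖WithLp.toLp 2 y‖ := by
      have h3 : WithLp.toLp 2 (Hi *ᵥ y)
          = WithLp.toLp 2 (Hi' *ᵥ y) - WithLp.toLp 2 ((Hi' - Hi) *ᵥ y) := by
        rw [← WithLp.toLp_sub, Matrix.sub_mulVec, sub_sub_cancel]
      rw [h3]
      refine (norm_sub_le _ _).trans ?_
      gcongr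
      refine (norm_toLp_mulVec_le _ _).trans ?_
      gcongr
    have h4 : ε * ‖WithLp.toLp 2 y‖ ≤ c / 2 * ‖WithLp.toLp 2 y‖ := by gcongr
    linarith
  have hunit := isUnit_det_of_bounded_below (by positivity) hbelow
  have hinv : ∀ y : Fin K → ℝ, ‖WithLp.toLp 2 (Hi'⁻¹ *ᵥ y)‖ ≤ 2 / c * ‖WithLp.toLp 2 y‖ := by
    intro y
    have h1 := hbelow (Hi'⁻¹ *ᵥ y)
    rw [Matrix.mulVec_mulVec, Matrix.mul_nonsing_inv _ hunit, Matrix.one_mulVec] at h1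
    rw [div_mul_eq_mul_div, le_div_iff₀ hc]
    linarith
  have hHj' : specNorm Hj' ≤ h + ε := by
    have := specNorm_add_le Hj (Hj' - Hj)
    rw [add_sub_cancel] at this
    linarith
  have hdec : Hj' *ᵥ (Hi'⁻¹ *ᵥ (Hi *ᵥ x - m)) - Hj *ᵥ x
      = (Hj' - Hj) *ᵥ (Hi'⁻¹ *ᵥ (Hi *ᵥ x)) + Hj *ᵥ (Hi'⁻¹ *ᵥ ((Hi - Hi') *ᵥ x))
        - Hj' *ᵥ (Hi'⁻¹ *ᵥ m) := by
    have h1 : Hi'⁻¹ *ᵥ (Hi' *ᵥ x) = x := by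
      rw [Matrix.mulVec_mulVec, Matrix.nonsing_inv_mul _ hunit, Matrix.one_mulVec]
    simp only [Matrix.mulVec_sub, Matrix.sub_mulVec, h1]
    abel
  have hb1 : ‖WithLp.toLp 2 ((Hj' - Hj) *ᵥ (Hi'⁻¹ *ᵥ (Hi *ᵥ x)))‖
      ≤ ε * (2 / c * (h * ‖WithLp.toLp 2 x‖)) := by
    refine (norm_toLp_mulVec_le _ _).trans ?_
    gcongr
    refine (hinv _).trans ?_
    gcongr
    refine (norm_toLp_mulVec_le _ _).trans ?_
    gcongr
  have hb2 : ‖WithLp.toLp 2 (Hj *ᵥ (Hi'⁻¹ *ᵥ ((Hi - Hi') *ᵥ x)))‖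
      ≤ h * (2 / c * (ε * ‖WithLp.toLp 2 x‖)) := by
    refine (norm_toLp_mulVec_le _ _).trans ?_
    gcongr
    refine (hinv _).trans ?_
    gcongr
    refine (norm_toLp_mulVec_le _ _).trans ?_
    rw [specNorm_sub_comm]
    gcongr
  have hb3 : ‖WithLp.toLp 2 (Hj' *ᵥ (Hi'⁻¹ *ᵥ m))‖ ≤ (h + ε) * (2 / c * ‖WithLp.toLp 2 m‖) := by
    refine (norm_toLp_mulVec_le _ _).trans ?_
    gcongr
    exact hinv _
  refine (norm_le_norm_toLp _).trans ?_
  rw [hdec, WithLp.toLp_sub, WithLp.toLp_add]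
  refine (norm_sub_le _ _).trans ((add_le_add (norm_add_le _ _) le_rfl).trans ?_)
  calc _ ≤ ε * (2 / c * (h * ‖WithLp.toLp 2 x‖)) + h * (2 / c * (ε * ‖WithLp.toLp 2 x‖))
        + (h + ε) * (2 / c * ‖WithLp.toLp 2 m‖) := add_le_add (add_le_add hb1 hb2) hb3
    _ = 4 * h / c * ε * ‖WithLp.toLp 2 x‖ + (h + ε) * (2 / c) * ‖WithLp.toLp 2 m‖ := by ring
    _ ≤ 4 * h / c * ε * (√K * ‖x‖) + (h + ε) * (2 / c) * (√K * ‖m‖) := by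
        gcongr
        · exact norm_toLp_le x
        · exact norm_toLp_le m
    _ = _ := by ring

end SpectralNorm

end FewTreatedDID

/-! ### Shocks, estimation error and bootstrap errors -/

namespace FewTreatedDID

section Deviation

variable {N₁ T K : ℕ} {𝒵 Ω : Type*} {D : Design N₁ T K 𝒵} {U : Unobserved N₁ T Ω}
  {E : ParamEstimator D}

theorem specNorm_le_maxDeviation {N₀ : ℕ} {j : Fin N₁} {u : PanelUnit N₁}
    (hu : u ∈ sampleOwnAndControls N₀ j) (ω : Ω) :
    specNorm (D.H j (D.Z u) (deltaHat E U N₀ j ω) - D.H j (D.Z u) (D.δ j))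
      ≤ maxDeviation E U N₀ j ω :=
  Finset.le_sup' (fun u => specNorm (D.H j (D.Z u) (deltaHat E U N₀ j ω)
    - D.H j (D.Z u) (D.δ j))) hu

end Deviation

section Model

variable {N₁ T K : ℕ} {𝒵 Ω : Type*} [MeasurableSpace Ω] {P : Measure Ω} {D : Design N₁ T K 𝒵}
  {U : Unobserved N₁ T Ω} {ξ : PanelUnit N₁ → Fin N₁ → Ω → Fin K → ℝ} {E : ParamEstimator D}
  {draw : ℕ → ℕ → Fin N₁ → Ω → ℕ}

/-- The normalized shock `H_j(Z_u; δ_j)⁻¹ B_j A_j η_u`, an everywhere measurable version of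
`ξ_{u,j}`. -/
noncomputable def normShock (D : Design N₁ T K 𝒵) (U : Unobserved N₁ T Ω) (u : PanelUnit N₁)
    (j : Fin N₁) (ω : Ω) : Fin K → ℝ :=
  (D.H j (D.Z u) (D.δ j))⁻¹ *ᵥ (D.BA j *ᵥ U.η u ω)

/-- The normalized shocks of the treated units, each with the matrices of its own model. -/
noncomputable def ownShocks (D : Design N₁ T K 𝒵) (U : Unobserved N₁ T Ω) (ω : Ω) :
    Fin N₁ → Fin K → ℝ :=
  fun j => normShock D U (Sum.inl j) j ω

/-- The common law of the normalized shocks of unit `j` and of the controls. -/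
noncomputable def shockLaw (P : Measure Ω) (D : Design N₁ T K 𝒵) (U : Unobserved N₁ T Ω)
    (j : Fin N₁) : Measure (Fin K → ℝ) :=
  P.map (normShock D U (Sum.inl j) j)

/-- The linear map `x ↦ ∑_j H_j(Z_j; δ_j) x_j` that turns normalized shocks into the error of the
estimator. -/
noncomputable def aggregate (D : Design N₁ T K 𝒵) (x : Fin N₁ → Fin K → ℝ) : Fin K → ℝ :=
  ∑ j, D.H j (D.Z (Sum.inl j)) (D.δ j) *ᵥ x j

/-- The mean over the first `N₀` controls of the shocks `B_j A_j η_i`. -/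
noncomputable def meanShock (D : Design N₁ T K 𝒵) (U : Unobserved N₁ T Ω) (N₀ : ℕ) (j : Fin N₁)
    (ω : Ω) : Fin K → ℝ :=
  (N₀ : ℝ)⁻¹ • ∑ i ∈ Finset.range N₀, D.BA j *ᵥ U.η (Sum.inr i) ω

theorem inl_mem_ownAndControls (j : Fin N₁) : (Sum.inl j : PanelUnit N₁) ∈ ownAndControls j :=
  Set.mem_insert _ _

theorem inr_mem_ownAndControls (j : Fin N₁) (i : ℕ) :
    (Sum.inr i : PanelUnit N₁) ∈ ownAndControls j :=
  Set.mem_insert_of_mem _ ⟨i, rfl⟩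

theorem isUnit_det_of_posDef {M : Matrix (Fin K) (Fin K) ℝ} (hM : M.PosDef) : IsUnit M.det :=
  isUnit_iff_ne_zero.2 hM.det_pos.ne'

theorem H_mulVec_normShock (hM : ParametricModel P D U ξ) {j : Fin N₁} {u : PanelUnit N₁}
    (hu : u ∈ ownAndControls j) (ω : Ω) :
    D.H j (D.Z u) (D.δ j) *ᵥ normShock D U u j ω = D.BA j *ᵥ U.η u ω := by
  rw [normShock, Matrix.mulVec_mulVec,
    Matrix.mul_nonsing_inv _ (isUnit_det_of_posDef (hM.posDef j u hu)), Matrix.one_mulVec]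

theorem normShock_ae_eq (hM : ParametricModel P D U ξ) {j : Fin N₁} {u : PanelUnit N₁}
    (hu : u ∈ ownAndControls j) : normShock D U u j =ᵐ[P] ξ u j := by
  filter_upwards [hM.model j u hu] with ω hω
  rw [normShock, hω, Matrix.mulVec_mulVec,
    Matrix.nonsing_inv_mul _ (isUnit_det_of_posDef (hM.posDef j u hu)), Matrix.one_mulVec]

theorem measurable_mulVec {m n : ℕ} (M : Matrix (Fin m) (Fin n) ℝ) :
    Measurable fun x : Fin n → ℝ => M *ᵥ x :=
  (Continuous.matrix_mulVec continuous_const continuous_id).measurable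

theorem measurable_normShock (hS : Sampling P U) (u : PanelUnit N₁) (j : Fin N₁) :
    Measurable (normShock D U u j) :=
  (measurable_mulVec _).comp ((measurable_mulVec _).comp (hS.measurable_η u))

theorem map_normShock (hM : ParametricModel P D U ξ) {j : Fin N₁} {u : PanelUnit N₁}
    (hu : u ∈ ownAndControls j) : P.map (normShock D U u j) = shockLaw P D U j := by
  rw [shockLaw, Measure.map_congr (normShock_ae_eq hM hu),
    Measure.map_congr (normShock_ae_eq hM (inl_mem_ownAndControls j))]
  exact (hM.identDistrib j u hu _ (inl_mem_ownAndControls j)).map_eq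

theorem isProbabilityMeasure_shockLaw [IsProbabilityMeasure P] (hS : Sampling P U) (j : Fin N₁) :
    IsProbabilityMeasure (shockLaw P D U j) :=
  Measure.isProbabilityMeasure_map (measurable_normShock hS _ j).aemeasurable

theorem memLp_mulVec_shock (hS : Sampling P U) {m : ℕ} (M : Matrix (Fin m) (Fin T) ℝ)
    (u : PanelUnit N₁) (k : Fin m) : MemLp (fun ω => (M *ᵥ U.η u ω) k) 2 P := by
  simp only [Matrix.mulVec, dotProduct]
  exact memLp_finsetSum _ fun t _ => (hS.secondMoment u t).const_mul _

theorem memLp_normShock (hS : Sampling P U) (u : PanelUnit N₁) (j : Fin N₁) :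
    MemLp (normShock D U u j) 2 P := by
  refine MemLp.of_eval fun k => ?_
  simp only [normShock, Matrix.mulVec_mulVec]
  exact memLp_mulVec_shock hS _ u k

theorem integrable_shockLaw [IsProbabilityMeasure P] (hS : Sampling P U) (j : Fin N₁) :
    Integrable (fun y => (1 + ‖y‖) ^ 2) (shockLaw P D U j) := by
  have h1 : MemLp (fun ω => 1 + ‖normShock D U (Sum.inl j) j ω‖) 2 P :=
    (memLp_const (1 : ℝ)).add (memLp_normShock hS _ j).norm
  rw [shockLaw, integrable_map_measure (by fun_prop) (measurable_normShock hS _ j).aemeasurable]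
  exact h1.integrable_sq

theorem integral_normShock (hM : ParametricModel P D U ξ) {j : Fin N₁}
    {u : PanelUnit N₁} (hu : u ∈ ownAndControls j) (k : Fin K) :
    ∫ ω, normShock D U u j ω k ∂P = 0 := by
  rw [integral_congr_ae ((normShock_ae_eq hM hu).mono fun ω hω => congrFun hω k),
    ← hM.mean_zero j k]
  exact ((hM.identDistrib j u hu _ (inl_mem_ownAndControls j)).comp
    (measurable_pi_apply k)).integral_eq

theorem resampling_normShock [IsProbabilityMeasure P] (hS : Sampling P U)
    (hM : ParametricModel P D U ξ) (hD : BootstrapDraws P U draw) :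
    Resampling P (shockLaw P D U) (fun i j => normShock D U (Sum.inr i) j) draw where
  measurable_row _ j := measurable_normShock hS _ j
  indep_row := (hS.indep.precomp Sum.inr_injective).comp
    (fun i (y : Fin T → ℝ) (j : Fin N₁) =>
      (D.H j (D.Z (Sum.inr i)) (D.δ j))⁻¹ *ᵥ (D.BA j *ᵥ y))
    fun _ => measurable_pi_lambda _ fun _ => (measurable_mulVec _).comp (measurable_mulVec _)
  law i j := map_normShock hM (inr_mem_ownAndControls j i)
  measurable_draw := hD.measurable_draw
  uniform := hD.uniform
  indep_draw := hD.indep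
  indep_row_draw N hN := (hD.indep_data N hN).comp
    (φ := fun q : (PanelUnit N₁ → Fin T → ℝ) × (PanelUnit N₁ → ℝ) × (Fin T → ℝ) =>
      fun (i : ℕ) (j : Fin N₁) => (D.H j (D.Z (Sum.inr i)) (D.δ j))⁻¹ *ᵥ (D.BA j *ᵥ q.1 (Sum.inr i)))
    (ψ := id)
    (measurable_pi_lambda _ fun _ => measurable_pi_lambda _ fun _ =>
      (measurable_mulVec _).comp ((measurable_mulVec _).comp
        ((measurable_pi_apply _).comp measurable_fst))) measurable_id

theorem indep_ownShocks (hS : Sampling P U) :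
    iIndepFun (fun j => normShock D U (Sum.inl j) j) P :=
  (hS.indep.precomp Sum.inl_injective).comp
    (fun j (y : Fin T → ℝ) => (D.H j (D.Z (Sum.inl j)) (D.δ j))⁻¹ *ᵥ (D.BA j *ᵥ y))
    fun _ => (measurable_mulVec _).comp (measurable_mulVec _)

theorem measurable_ownShocks (hS : Sampling P U) : Measurable (ownShocks D U) :=
  measurable_pi_lambda _ fun j => measurable_normShock hS _ j

theorem map_ownShocks [IsProbabilityMeasure P] (hS : Sampling P U) :
    P.map (ownShocks D U) = Measure.pi (shockLaw P D U) :=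
  (indep_ownShocks hS).map_fun_eq_pi_map fun j => (measurable_normShock hS _ j).aemeasurable

theorem aggregate_ownShocks (hM : ParametricModel P D U ξ) (ω : Ω) :
    aggregate D (ownShocks D U ω) = ∑ j, D.BA j *ᵥ U.η (Sum.inl j) ω :=
  Finset.sum_congr rfl fun j _ => H_mulVec_normShock hM (inl_mem_ownAndControls j) ω

theorem measurable_aggregate : Measurable (aggregate D) :=
  Finset.measurable_sum _ fun j _ => (measurable_mulVec _).comp (measurable_pi_apply j)

theorem norm_aggregate_le {h : ℝ}
    (hh : ∀ j, specNorm (D.H j (D.Z (Sum.inl j)) (D.δ j)) ≤ h) (x : Fin N₁ → Fin K → ℝ) :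
    ‖aggregate D x‖ ≤ N₁ * (√K * h) * ‖x‖ := by
  calc ‖aggregate D x‖ ≤ ∑ j : Fin N₁, √K * h * ‖x‖ := by
        refine (norm_sum_le _ _).trans (Finset.sum_le_sum fun j _ => ?_)
        have h0 := (specNorm_nonneg _).trans (hh j)
        refine (norm_mulVec_le _ _).trans ?_
        gcongr
        · exact hh j
        · exact norm_le_pi_norm x j
    _ = _ := by simp; ring

/-- Every coordinate of the limiting error has an atomless distribution: one independent summand is
atomless already. -/
theorem measure_aggregate_eq [IsProbabilityMeasure P] (hN₁ : 0 < N₁) (hS : Sampling P U)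
    (hM : ParametricModel P D U ξ) (s : Fin K) (c : ℝ) :
    P {ω | aggregate D (ownShocks D U ω) s = c} = 0 := by
  let a : Fin N₁ → Ω → ℝ := fun j ω =>
    (D.H j (D.Z (Sum.inl j)) (D.δ j) *ᵥ normShock D U (Sum.inl j) j ω) s
  have ham : ∀ j, Measurable (a j) := fun j =>
    (measurable_pi_apply s).comp ((measurable_mulVec _).comp (measurable_normShock hS _ j))
  have hai : iIndepFun a P := (indep_ownShocks hS).comp
    (fun j (x : Fin K → ℝ) => (D.H j (D.Z (Sum.inl j)) (D.δ j) *ᵥ x) s)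
    fun j => (measurable_pi_apply s).comp (measurable_mulVec _)
  let j₀ : Fin N₁ := ⟨0, hN₁⟩
  let R : Ω → ℝ := ∑ j ∈ Finset.univ.erase j₀, a j
  have hRm : Measurable R := by
    have : R = fun ω => ∑ j ∈ Finset.univ.erase j₀, a j ω := by ext ω; simp [R]
    rw [this]
    exact Finset.measurable_sum _ fun j _ => ham j
  have hsum : ∀ ω, aggregate D (ownShocks D U ω) s = R ω + a j₀ ω := by
    intro ω
    have h1 : R ω = ∑ j ∈ Finset.univ.erase j₀, a j ω := by simp [R]
    rw [h1, Finset.sum_erase_add _ _ (Finset.mem_univ j₀), aggregate, Finset.sum_apply]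
    rfl
  have hatom : ∀ t, P.map (a j₀) {t} = 0 := by
    intro t
    let row : Fin K → ℝ := fun l => D.H j₀ (D.Z (Sum.inl j₀)) (D.δ j₀) s l
    have hrow : row ≠ 0 := by
      intro h0
      have := (hM.posDef j₀ _ (inl_mem_ownAndControls j₀)).diag_pos (i := s)
      rw [show D.H j₀ (D.Z (Sum.inl j₀)) (D.δ j₀) s s = 0 from congrFun h0 s] at this
      exact lt_irrefl _ this
    have hset : MeasurableSet {x : Fin K → ℝ | row ⬝ᵥ x = t} :=
      measurableSet_eq_fun (Continuous.dotProduct continuous_const continuous_id).measurable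
        measurable_const
    have h2 := hM.continuous j₀ row hrow t
    rw [← Measure.map_congr (normShock_ae_eq hM (inl_mem_ownAndControls j₀)),
      Measure.map_apply (measurable_normShock hS _ j₀) hset] at h2
    rw [Measure.map_apply (ham j₀) (measurableSet_singleton t)]
    exact h2
  have hind : IndepFun R (a j₀) P :=
    hai.indepFun_finsetSum_of_notMem ham (Finset.notMem_erase j₀ _)
  have hmap := (indepFun_iff_map_prod_eq_prod_map_map hRm.aemeasurable
    (ham j₀).aemeasurable).1 hind
  have hset : MeasurableSet {q : ℝ × ℝ | q.1 + q.2 = c} :=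
    measurableSet_eq_fun (measurable_fst.add measurable_snd) measurable_const
  have hzero : P.map (fun ω => (R ω, a j₀ ω)) {q : ℝ × ℝ | q.1 + q.2 = c} = 0 := by
    have : IsProbabilityMeasure (P.map (a j₀)) :=
      Measure.isProbabilityMeasure_map (ham j₀).aemeasurable
    rw [hmap, Measure.measure_prod_null hset]
    refine Eventually.of_forall fun r => ?_
    have : Prod.mk r ⁻¹' {q : ℝ × ℝ | q.1 + q.2 = c} = {c - r} := by
      ext t
      simp only [Set.mem_preimage, Set.mem_ofPred_eq, Set.mem_singleton_iff]
      exact ⟨fun h => by linarith, fun h => by linarith⟩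
    show P.map (a j₀) (Prod.mk r ⁻¹' {q : ℝ × ℝ | q.1 + q.2 = c}) = 0
    rw [this]
    exact hatom _
  rw [Measure.map_apply (hRm.prodMk (ham j₀)) hset] at hzero
  simp_rw [hsum]
  exact hzero

theorem not_isTreated_inr (i : ℕ) (t : Fin T) : ¬ D.IsTreated (Sum.inr i) t := by
  simp [Design.IsTreated, Design.lastPreUnit]

theorem BA_mulVec_const_add (hT : ParallelTrends P D U) (j : Fin N₁) (c : ℝ) (v : Fin T → ℝ) :
    (D.BA j *ᵥ fun t => c + v t) = D.BA j *ᵥ v := by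
  ext k
  simp only [Matrix.mulVec, dotProduct, mul_add, Finset.sum_add_distrib, ← Finset.sum_mul,
    hT.rowSum j k, zero_mul, zero_add]

theorem BA_mulVec_outcome_inr (hT : ParallelTrends P D U) (j : Fin N₁) (i : ℕ) (ω : Ω) :
    D.BA j *ᵥ outcome D U (Sum.inr i) ω
      = (D.BA j *ᵥ fun t => U.γ t ω) + D.BA j *ᵥ U.η (Sum.inr i) ω := by
  have : outcome D U (Sum.inr i) ω
      = fun t => U.θ (Sum.inr i) ω + ((fun t => U.γ t ω) + U.η (Sum.inr i) ω) t := by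
    ext t
    rw [outcome, if_neg (not_isTreated_inr i t), Unobserved.outcomeUntreated, Pi.add_apply,
      add_assoc]
  rw [this, BA_mulVec_const_add hT, Matrix.mulVec_add]

theorem BA_mulVec_outcome_inl (hT : ParallelTrends P D U) (j : Fin N₁) (ω : Ω) :
    D.BA j *ᵥ outcome D U (Sum.inl j) ω
      = (D.BA j *ᵥ fun t => U.γ t ω) + D.BA j *ᵥ U.η (Sum.inl j) ω + D.BA j *ᵥ D.effectVec j := by
  have : outcome D U (Sum.inl j) ω = fun t => U.θ (Sum.inl j) ω +
      ((fun t => U.γ t ω) + U.η (Sum.inl j) ω + D.effectVec j) t := by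
    ext t
    simp only [outcome, outcomeTreated, Unobserved.outcomeUntreated, Design.effectVec, Pi.add_apply]
    split_ifs <;> ring
  rw [this, BA_mulVec_const_add hT, Matrix.mulVec_add, Matrix.mulVec_add]

theorem average_BA_mulVec_outcome (hT : ParallelTrends P D U) {N₀ : ℕ} (hN₀ : 0 < N₀)
    (j : Fin N₁) (ω : Ω) :
    (N₀ : ℝ)⁻¹ • ∑ i ∈ Finset.range N₀, D.BA j *ᵥ outcome D U (Sum.inr i) ω
      = (D.BA j *ᵥ fun t => U.γ t ω) + meanShock D U N₀ j ω := by
  have hN : (N₀ : ℝ) ≠ 0 := by exact_mod_cast hN₀.ne'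
  rw [meanShock, Finset.sum_congr rfl fun i _ => BA_mulVec_outcome_inr hT j i ω,
    Finset.sum_add_distrib, smul_add, Finset.sum_const, Finset.card_range, ← Nat.cast_smul_eq_nsmul ℝ,
    smul_smul, inv_mul_cancel₀ hN, one_smul]

theorem residual_eq (hT : ParallelTrends P D U) {N₀ : ℕ} (hN₀ : 0 < N₀) (j : Fin N₁) (i : ℕ)
    (ω : Ω) : residual D U N₀ j i ω = D.BA j *ᵥ U.η (Sum.inr i) ω - meanShock D U N₀ j ω := by
  rw [residual, average_BA_mulVec_outcome hT hN₀, BA_mulVec_outcome_inr hT, add_sub_add_left_eq_sub]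

theorem estimator_sub_target (hT : ParallelTrends P D U) (hM : ParametricModel P D U ξ) {N₀ : ℕ}
    (hN₀ : 0 < N₀) (ω : Ω) :
    estimator D U N₀ ω - D.target
      = aggregate D (ownShocks D U ω) - ∑ j, meanShock D U N₀ j ω := by
  rw [aggregate_ownShocks hM, estimator, Design.target, ← Finset.sum_sub_distrib,
    ← Finset.sum_sub_distrib]
  refine Finset.sum_congr rfl fun j _ => ?_
  have h1 : D.BA j *ᵥ controlMean D U N₀ ω
      = (D.BA j *ᵥ fun t => U.γ t ω) + meanShock D U N₀ j ω := by
    rw [← average_BA_mulVec_outcome hT hN₀, controlMean, Matrix.mulVec_smul, Matrix.mulVec_sum]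
  rw [Matrix.mulVec_sub, h1, BA_mulVec_outcome_inl hT]
  abel

/-- The weak law of large numbers for the control means: the summands are independent, centred, and
have uniformly bounded second moments. -/
theorem tendsto_meanShock [IsProbabilityMeasure P] (hS : Sampling P U)
    (hM : ParametricModel P D U ξ) {h : ℝ}
    (hh : ∀ j, ∀ u ∈ ownAndControls j, specNorm (D.H j (D.Z u) (D.δ j)) ≤ h) (j : Fin N₁) :
    Tendsto (fun p : ℕ × Ω => meanShock D U p.1 j p.2) (inProb P atTop) (𝓝 0) := by
  rw [tendsto_pi_nhds]
  intro k
  let X : ℕ → Ω → ℝ := fun i ω => (D.BA j *ᵥ U.η (Sum.inr i) ω) k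
  have hXL : ∀ i, MemLp (X i) 2 P := fun i => memLp_mulVec_shock hS _ _ k
  have hX0 : ∀ i, ∫ ω, X i ω ∂P = 0 := by
    intro i
    have h1 : X i = fun ω => ∑ l, D.H j (D.Z (Sum.inr i)) (D.δ j) k l *
        normShock D U (Sum.inr i) j ω l := by
      ext ω
      simp only [X]
      rw [← H_mulVec_normShock hM (inr_mem_ownAndControls j i) ω]
      rfl
    rw [h1, integral_finsetSum]
    · simp_rw [integral_const_mul, integral_normShock hM (inr_mem_ownAndControls j i)]
      simp
    · exact fun l _ => ((memLp_normShock hS (Sum.inr i) j).eval l |>.integrable (by simp)).const_mul _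
  set C := ∫ y, (√K * h * ‖y‖) ^ 2 ∂(shockLaw P D U j) with hC
  have hXC : ∀ i, ∫ ω, X i ω ^ 2 ∂P ≤ C := by
    intro i
    rw [hC, ← map_normShock hM (inr_mem_ownAndControls j i),
      integral_map (measurable_normShock hS _ j).aemeasurable (by fun_prop)]
    refine integral_mono (hXL i).integrable_sq
      ((memLp_normShock hS (Sum.inr i) j).norm.const_mul (√K * h)).integrable_sq fun ω => ?_
    refine sq_le_sq' ?_ ?_ <;>
    · have h1 : |X i ω| ≤ √K * h * ‖normShock D U (Sum.inr i) j ω‖ := by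
        simp only [X]
        rw [← H_mulVec_normShock hM (inr_mem_ownAndControls j i) ω]
        refine (norm_le_pi_norm (D.H j (D.Z (Sum.inr i)) (D.δ j) *ᵥ
          normShock D U (Sum.inr i) j ω) k).trans ((norm_mulVec_le _ _).trans ?_)
        gcongr
        exact hh j _ (inr_mem_ownAndControls j i)
      have := abs_le.1 h1
      linarith [this.1, this.2]
  have hind : iIndepFun X P := (hS.indep.precomp Sum.inr_injective).comp
    (fun _ (y : Fin T → ℝ) => (D.BA j *ᵥ y) k)
    fun _ => (measurable_pi_apply k).comp (measurable_mulVec _)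
  have hmean : ∀ N₀ ω, meanShock D U N₀ j ω k = (N₀ : ℝ)⁻¹ * (∑ i ∈ Finset.range N₀, X i) ω := by
    intro N₀ ω
    simp [meanShock, X]
  have hmem : ∀ N₀ : ℕ, MemLp (∑ i ∈ Finset.range N₀, X i) 2 P := fun N₀ =>
    memLp_finsetSum' _ fun i _ => hXL i
  refine tendsto_inProb_of_integral_sq (f := fun N₀ ω => meanShock D U N₀ j ω k) (fun N₀ => ?_) ?_
  · simp_rw [hmean]
    exact (hmem N₀).const_mul _
  · have hlim : Tendsto (fun N₀ : ℕ => C / N₀) atTop (𝓝 0) :=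
      tendsto_const_div_atTop_nhds_zero_nat C
    refine tendsto_of_tendsto_of_tendsto_of_le_of_le' tendsto_const_nhds hlim
      (Eventually.of_forall fun N₀ => integral_nonneg fun ω => sq_nonneg _) ?_
    filter_upwards [eventually_gt_atTop 0] with N₀ hN₀
    have hN : (0 : ℝ) < N₀ := by exact_mod_cast hN₀
    simp_rw [hmean, mul_pow]
    rw [integral_const_mul]
    have hvar : ∫ ω, (∑ i ∈ Finset.range N₀, X i) ω ^ 2 ∂P ≤ N₀ * C := by
      have h0 : ∫ ω, (∑ i ∈ Finset.range N₀, X i) ω ∂P = 0 := by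
        simp_rw [Finset.sum_apply]
        rw [integral_finsetSum _ fun i _ => (hXL i).integrable (by simp)]
        simp [hX0]
      rw [← variance_of_integral_eq_zero (hmem N₀).1.aemeasurable h0,
        IndepFun.variance_sum (fun i _ => hXL i) fun i _ i' _ hii' => hind.indepFun hii']
      calc ∑ i ∈ Finset.range N₀, variance (X i) P ≤ ∑ i ∈ Finset.range N₀, C := by
            refine Finset.sum_le_sum fun i _ => ?_
            rw [variance_of_integral_eq_zero (hXL i).1.aemeasurable (hX0 i)]
            exact hXC i
        _ = N₀ * C := by simp
    calc ((N₀ : ℝ)⁻¹) ^ 2 * ∫ ω, (∑ i ∈ Finset.range N₀, X i) ω ^ 2 ∂P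
        ≤ ((N₀ : ℝ)⁻¹) ^ 2 * (N₀ * C) := by gcongr
      _ = C / N₀ := by field_simp

theorem ae_draw_lt [IsProbabilityMeasure P] (hD : BootstrapDraws P U draw) {N₀ : ℕ} (hN₀ : 0 < N₀) :
    ∀ᵐ ω ∂P, ∀ b j, draw N₀ b j ω < N₀ :=
  ae_all_iff.2 fun b => ae_all_iff.2 fun j =>
    ae_lt_of_uniform hN₀ (hD.measurable_draw N₀ b j) (hD.uniform N₀ b j)

/-- The resampled normalized shocks that underlie the bootstrap error `ê_b`. -/
noncomputable def drawnShocks (D : Design N₁ T K 𝒵) (U : Unobserved N₁ T Ω)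
    (draw : ℕ → ℕ → Fin N₁ → Ω → ℕ) (N₀ b : ℕ) (ω : Ω) : Fin N₁ → Fin K → ℝ :=
  resample (fun i j => normShock D U (Sum.inr i) j) draw N₀ b ω

/-- A deterministic bound for the difference between a bootstrap error and the error formed with the
true matrices. -/
theorem norm_bootError_sub_le (hT : ParallelTrends P D U) (hM : ParametricModel P D U ξ)
    {c h : ℝ} (hc : 0 < c)
    (hmin : ∀ (j : Fin N₁) (i : ℕ), c ≤ lambdaMin (D.H j (D.Z (Sum.inr i)) (D.δ j)))
    (hmax : ∀ j, ∀ u ∈ ownAndControls j, specNorm (D.H j (D.Z u) (D.δ j)) ≤ h)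
    {N₀ : ℕ} (hN₀ : 0 < N₀) {b : ℕ} {ω : Ω} (hdraw : ∀ j, draw N₀ b j ω < N₀)
    (hdev : ∀ j, maxDeviation E U N₀ j ω ≤ c / 2) :
    ‖bootError E U draw N₀ b ω - aggregate D (drawnShocks D U draw N₀ b ω)‖
      ≤ (∑ j, √K * (4 * h / c * maxDeviation E U N₀ j ω
        + (h + maxDeviation E U N₀ j ω) * (2 / c) * ‖meanShock D U N₀ j ω‖))
        * (1 + ‖drawnShocks D U draw N₀ b ω‖) := by
  set x := drawnShocks D U draw N₀ b ω with hx
  rw [bootError, aggregate, ← Finset.sum_sub_distrib, Finset.sum_mul]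
  refine (norm_sum_le _ _).trans (Finset.sum_le_sum fun j _ => ?_)
  have hown : Sum.inl j ∈ sampleOwnAndControls N₀ j := Finset.mem_insert_self _ _
  have hctl : Sum.inr (draw N₀ b j ω) ∈ sampleOwnAndControls N₀ j :=
    Finset.mem_insert_of_mem (Finset.mem_image_of_mem _ (Finset.mem_range.2 (hdraw j)))
  have hi := inr_mem_ownAndControls j (draw N₀ b j ω)
  have hh0 : 0 ≤ h := (specNorm_nonneg _).trans (hmax j _ hi)
  set e := maxDeviation E U N₀ j ω with he
  have he0 : 0 ≤ e := (specNorm_nonneg _).trans (specNorm_le_maxDeviation hown ω)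
  have key := norm_rescale_sub_le hc (hM.posDef j _ hi).isHermitian (hmin j (draw N₀ b j ω))
    (hmax j _ hi) (hmax j _ (inl_mem_ownAndControls j)) (specNorm_le_maxDeviation (E := E) hctl ω)
    (specNorm_le_maxDeviation (E := E) hown ω) (hdev j) (x j) (meanShock D U N₀ j ω)
  have hres : residual D U N₀ j (draw N₀ b j ω) ω
      = D.H j (D.Z (Sum.inr (draw N₀ b j ω))) (D.δ j) *ᵥ x j - meanShock D U N₀ j ω := by
    rw [residual_eq hT hN₀, ← H_mulVec_normShock hM hi]
    rfl
  rw [normResidual, hres]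
  refine key.trans ?_
  rw [mul_assoc √(K : ℝ), ← he]
  refine mul_le_mul_of_nonneg_left ?_ (Real.sqrt_nonneg _)
  rw [add_mul (4 * h / c * e)]
  have hxj : ‖x j‖ ≤ 1 + ‖x‖ := (norm_le_pi_norm x j).trans (by linarith)
  have h1 : 1 ≤ 1 + ‖x‖ := by linarith [norm_nonneg x]
  have h2 : 0 ≤ (h + e) * (2 / c) * ‖meanShock D U N₀ j ω‖ := by positivity
  exact add_le_add (mul_le_mul_of_nonneg_left hxj
    (show 0 ≤ 4 * h / c * e by positivity)) (le_mul_of_one_le_right h2 h1)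

/-- The bootstrap errors are, uniformly over the replications, close to the errors formed with the
true matrices and the resampled normalized shocks, in the sense of a factor `r → 0`. -/
theorem exists_bootError_bound [IsProbabilityMeasure P] (hS : Sampling P U)
    (hT : ParallelTrends P D U) (hM : ParametricModel P D U ξ) (hR : Regularity P D E U)
    (hD : BootstrapDraws P U draw) :
    ∃ r : ℕ × Ω → ℝ, Tendsto r (inProb P atTop) (𝓝 0) ∧
      ∀ᶠ p in inProb P atTop, ∀ b,
        ‖bootError E U draw p.1 b p.2 - aggregate D (drawnShocks D U draw p.1 b p.2)‖
          ≤ r p * (1 + ‖drawnShocks D U draw p.1 b p.2‖) := by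
  obtain ⟨c, h, hc, hch, hmin, hmax⟩ := hR.bounds
  have hdev : ∀ j, Tendsto (fun p : ℕ × Ω => maxDeviation E U p.1 j p.2) (inProb P atTop) (𝓝 0) :=
    fun j => (tendstoInMeasure_const_iff (f := fun N₀ ω => maxDeviation E U N₀ j ω)).1
      (hR.consistent j)
  have hmean := fun j => tendsto_meanShock hS hM hmax j
  refine ⟨fun p => ∑ j, √K * (4 * h / c * maxDeviation E U p.1 j p.2
    + (h + maxDeviation E U p.1 j p.2) * (2 / c) * ‖meanShock D U p.1 j p.2‖), ?_, ?_⟩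
  · have := tendsto_finsetSum (Finset.univ : Finset (Fin N₁)) fun j _ =>
      (((hdev j).const_mul (4 * h / c)).add
        ((((hdev j).const_add h).mul_const (2 / c)).mul (hmean j).norm)).const_mul √K
    simpa using this
  · have hsmall : ∀ᶠ p in inProb P atTop, ∀ j, maxDeviation E U p.1 j p.2 ≤ c / 2 :=
      eventually_all.2 fun j => (hdev j).eventually_le_const (by positivity)
    filter_upwards [hsmall, eventually_inProb_of_eventually (P := P) (eventually_gt_atTop 0),
      eventually_inProb_of_ae (P := P) (q := fun N₀ ω => ∀ b j, draw N₀ b j ω < N₀)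
        ((eventually_gt_atTop 0).mono fun N₀ hN₀ => ae_draw_lt hD hN₀)] with p hp hN₀ hdraw b
    exact norm_bootError_sub_le hT hM hc hmin hmax hN₀ (hdraw b) hp

end Model

end FewTreatedDID

/-! ### Studentized maxima, empirical quantiles and perturbed distribution functions -/

namespace FewTreatedDID

section MaxRatio

variable {K : ℕ}

/-- The studentized maximum `max_s |e_s / ι_s|`. -/
noncomputable def maxRatio (e ι : Fin K → ℝ) : ℝ := ⨆ s, |e s / ι s|

theorem maxRatio_nonneg (e ι : Fin K → ℝ) : 0 ≤ maxRatio e ι :=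
  Real.iSup_nonneg fun _ => abs_nonneg _

theorem abs_div_le_maxRatio (e ι : Fin K → ℝ) (s : Fin K) : |e s / ι s| ≤ maxRatio e ι :=
  le_ciSup (f := fun s => |e s / ι s|) (Set.finite_range _).bddAbove s

theorem maxRatio_le_iff (hK : 0 < K) {e ι : Fin K → ℝ} {q : ℝ} :
    maxRatio e ι ≤ q ↔ ∀ s, |e s / ι s| ≤ q := by
  have : Nonempty (Fin K) := ⟨⟨0, hK⟩⟩
  exact ciSup_le_iff (Set.finite_range _).bddAbove

theorem measurable_maxRatio (ι : Fin K → ℝ) : Measurable fun e : Fin K → ℝ => maxRatio e ι :=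
  Measurable.iSup fun s => by fun_prop

theorem abs_maxRatio_sub_le (hK : 0 < K) {e e' ι ι' : Fin K → ℝ} {δ : ℝ}
    (h : ∀ s, |e s / ι s - e' s / ι' s| ≤ δ) : |maxRatio e ι - maxRatio e' ι'| ≤ δ := by
  have h1 : maxRatio e ι ≤ maxRatio e' ι' + δ := (maxRatio_le_iff hK).2 fun s => by
    have := abs_sub_abs_le_abs_sub (e s / ι s) (e' s / ι' s)
    linarith [h s, abs_div_le_maxRatio e' ι' s]
  have h2 : maxRatio e' ι' ≤ maxRatio e ι + δ := (maxRatio_le_iff hK).2 fun s => by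
    have := abs_sub_abs_le_abs_sub (e' s / ι' s) (e s / ι s)
    rw [abs_sub_comm] at this
    linarith [h s, abs_div_le_maxRatio e ι s]
  exact abs_le.2 ⟨by linarith, by linarith⟩

/-- Errors in the numerators, relative to `1 + n`, and in the normalizing constants move the
studentized maximum by at most the stated multiple of `1 + n`. -/
theorem abs_maxRatio_sub_le_mul (hK : 0 < K) {e e' ι ι' : Fin K → ℝ} {r C n : ℝ}
    (hC : 0 ≤ C) (he : ‖e - e'‖ ≤ r * (1 + n)) (he' : ‖e'‖ ≤ C * n) :
    |maxRatio e ι - maxRatio e' ι'|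
      ≤ (r * (∑ s, |(ι s)⁻¹|) + C * ∑ s, |(ι s)⁻¹ - (ι' s)⁻¹|) * (1 + n) := by
  refine abs_maxRatio_sub_le hK fun s => ?_
  have h1 : e s / ι s - e' s / ι' s = (e - e') s * (ι s)⁻¹ + e' s * ((ι s)⁻¹ - (ι' s)⁻¹) := by
    simp only [Pi.sub_apply, div_eq_mul_inv]; ring
  have h2 : |(ι s)⁻¹| ≤ ∑ s, |(ι s)⁻¹| :=
    Finset.single_le_sum (f := fun s => |(ι s)⁻¹|) (fun _ _ => abs_nonneg _) (Finset.mem_univ s)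
  have h3 : |(ι s)⁻¹ - (ι' s)⁻¹| ≤ ∑ s, |(ι s)⁻¹ - (ι' s)⁻¹| :=
    Finset.single_le_sum (f := fun s => |(ι s)⁻¹ - (ι' s)⁻¹|) (fun _ _ => abs_nonneg _)
      (Finset.mem_univ s)
  have h4 : |(e - e') s| ≤ r * (1 + n) := (norm_le_pi_norm (e - e') s).trans he
  have h5 : |e' s| ≤ C * (1 + n) := by
    refine (norm_le_pi_norm e' s).trans (he'.trans ?_)
    gcongr
    linarith
  rw [h1]
  refine (abs_add_le _ _).trans ?_
  rw [abs_mul, abs_mul]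
  calc |(e - e') s| * |(ι s)⁻¹| + |e' s| * |(ι s)⁻¹ - (ι' s)⁻¹|
      ≤ r * (1 + n) * (∑ s, |(ι s)⁻¹|) + C * (1 + n) * ∑ s, |(ι s)⁻¹ - (ι' s)⁻¹| :=
        add_le_add (mul_le_mul h4 h2 (abs_nonneg _) ((abs_nonneg _).trans h4))
          (mul_le_mul h5 h3 (abs_nonneg _) ((abs_nonneg _).trans h5))
    _ = _ := by ring

end MaxRatio

section Quantile

theorem card_filter_div_eq_average (B : ℕ) (q : ℕ → Prop) [DecidablePred q] :
    (((Finset.range B).filter q).card : ℝ) / B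
      = (∑ b ∈ Finset.range B, if q b then (1 : ℝ) else 0) / B := by
  rw [Finset.sum_boole]

theorem empQuantile_le {B : ℕ} {x : ℕ → ℝ} {p c : ℝ} (hp : 0 < p) (hx : ∀ b, 0 ≤ x b)
    (h : p ≤ (((Finset.range B).filter fun b => x b ≤ c).card : ℝ) / B) :
    empQuantile B x p ≤ c := by
  refine csInf_le ⟨0, fun d hd => ?_⟩ h
  have hd' : p ≤ (((Finset.range B).filter fun b => x b ≤ d).card : ℝ) / B := hd
  have hne : ((Finset.range B).filter fun b => x b ≤ d).Nonempty := by
    rw [Finset.nonempty_iff_ne_empty]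
    intro h0
    rw [h0] at hd'
    simp only [Finset.card_empty, Nat.cast_zero, zero_div] at hd'
    linarith
  obtain ⟨b, hb⟩ := hne
  exact (hx b).trans (Finset.mem_filter.1 hb).2

theorem le_empQuantile {B : ℕ} (hB : 0 < B) {x : ℕ → ℝ} {p c : ℝ} (hp : p ≤ 1)
    (h : (((Finset.range B).filter fun b => x b ≤ c).card : ℝ) / B < p) :
    c ≤ empQuantile B x p := by
  refine le_csInf ?_ fun d hd => ?_
  · obtain ⟨M, hM⟩ := ((Finset.range B).image x).bddAbove
    refine ⟨M, ?_⟩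
    have hall : (Finset.range B).filter (fun b => x b ≤ M) = Finset.range B :=
      Finset.filter_true_of_mem fun b hb => hM (Finset.mem_coe.2 (Finset.mem_image_of_mem x hb))
    show p ≤ (((Finset.range B).filter fun b => x b ≤ M).card : ℝ) / B
    rw [hall, Finset.card_range, div_self (by exact_mod_cast hB.ne')]
    exact hp
  · by_contra! hlt
    have hd' : p ≤ (((Finset.range B).filter fun b => x b ≤ d).card : ℝ) / B := hd
    have hle : (((Finset.range B).filter fun b => x b ≤ d).card : ℝ) / B
        ≤ (((Finset.range B).filter fun b => x b ≤ c).card : ℝ) / B := by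
      gcongr with b
    linarith

theorem empVariance_eq {B : ℕ} (hB : 0 < B) (x : ℕ → ℝ) :
    empVariance B x = (∑ b ∈ Finset.range B, x b ^ 2) / B - ((∑ b ∈ Finset.range B, x b) / B) ^ 2 := by
  have hB' : (B : ℝ) ≠ 0 := by exact_mod_cast hB.ne'
  rw [empVariance]
  simp only [sub_sq, Finset.sum_add_distrib, Finset.sum_sub_distrib, Finset.sum_const,
    Finset.card_range, nsmul_eq_mul, ← Finset.sum_mul, ← Finset.mul_sum]
  field_simp
  ring

end Quantile

section Perturbation

variable {X : Type*} [MeasurableSpace X] {Q : Measure X}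

/-- For an atomless statistic `W`, the probability of `W + η n ≤ c` is continuous in `(η, c)` at
`η = 0`. -/
theorem tendsto_measureReal_perturbed_le [IsFiniteMeasure Q] {W n : X → ℝ} (hW : Measurable W)
    (hn : Measurable n) (hatom : ∀ c, Q {x | W x = c} = 0) (c : ℝ) :
    Tendsto (fun q : ℝ × ℝ => Q.real {x | W x + q.1 * n x ≤ q.2}) (𝓝 (0, c))
      (𝓝 (Q.real {x | W x ≤ c})) := by
  refine (ENNReal.tendsto_toReal (measure_ne_top _ _)).comp
    (tendsto_measure_of_ae_tendsto_indicator_of_isFiniteMeasure (𝓝 (0, c))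
      (measurableSet_le hW measurable_const)
      (fun q => measurableSet_le (hW.add (hn.const_mul q.1)) measurable_const) ?_)
  filter_upwards [measure_eq_zero_iff_ae_notMem.1 (hatom c)] with x hx
  have hx' : W x ≠ c := hx
  have hcont : Tendsto (fun q : ℝ × ℝ => W x + q.1 * n x - q.2) (𝓝 (0, c)) (𝓝 (W x - c)) := by
    have : Continuous fun q : ℝ × ℝ => W x + q.1 * n x - q.2 := by fun_prop
    simpa using this.tendsto (0, c)
  rcases lt_or_gt_of_ne hx' with hlt | hgt
  · filter_upwards [hcont.eventually_lt_const (sub_neg.2 hlt)] with q hq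
    exact iff_of_true (show W x + q.1 * n x ≤ q.2 by linarith) hlt.le
  · filter_upwards [hcont.eventually_const_lt (sub_pos.2 hgt)] with q hq
    exact iff_of_false (show ¬ W x + q.1 * n x ≤ q.2 by linarith) (not_le.2 hgt)

theorem exists_measureReal_le_eq [IsProbabilityMeasure Q] {W : X → ℝ} (hW : Measurable W)
    (hatom : ∀ c, Q {x | W x = c} = 0) {y : ℝ} (hy0 : 0 < y) (hy1 : y < 1) :
    ∃ c, Q.real {x | W x ≤ c} = y := by
  have hprob : IsProbabilityMeasure (Q.map W) := Measure.isProbabilityMeasure_map hW.aemeasurable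
  have hcdf : ∀ c, Q.real {x | W x ≤ c} = cdf (Q.map W) c := by
    intro c
    rw [cdf_eq_real, map_measureReal_apply hW measurableSet_Iic]
    rfl
  have hcont : Continuous fun c => Q.real {x | W x ≤ c} := by
    rw [continuous_iff_continuousAt]
    intro c
    have h1 := (tendsto_measureReal_perturbed_le hW (measurable_const (a := (0 : ℝ))) hatom c).comp
      ((Continuous.prodMk_right (0 : ℝ)).tendsto c)
    simp only [Function.comp_def, zero_mul, add_zero] at h1
    exact h1
  obtain ⟨c, hc⟩ := mem_range_of_exists_le_of_exists_ge hcont (c := y)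
    (by
      obtain ⟨a, ha⟩ := ((tendsto_cdf_atBot (Q.map W)).eventually_lt_const hy0).exists
      exact ⟨a, (hcdf a).trans_le ha.le⟩)
    (by
      obtain ⟨a, ha⟩ := ((tendsto_cdf_atTop (Q.map W)).eventually_const_lt hy1).exists
      exact ⟨a, ha.le.trans (hcdf a).ge⟩)
  exact ⟨c, hc⟩

theorem exists_pos_perturbed_lt [IsFiniteMeasure Q] {W n : X → ℝ} (hW : Measurable W)
    (hn : Measurable n) (hatom : ∀ c, Q {x | W x = c} = 0) {c p : ℝ}
    (h : Q.real {x | W x ≤ c} < p) : ∃ η > 0, Q.real {x | W x + (-η) * n x ≤ c} < p := by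
  have hu : Tendsto (fun η : ℝ => ((-η, c) : ℝ × ℝ)) (𝓝[>] 0) (𝓝 (0, c)) := by
    have : Continuous fun η : ℝ => ((-η, c) : ℝ × ℝ) := by fun_prop
    simpa using (this.tendsto 0).mono_left nhdsWithin_le_nhds
  obtain ⟨η, hη, hη0⟩ := (((tendsto_measureReal_perturbed_le hW hn hatom c).comp
    hu).eventually_lt_const h |>.and self_mem_nhdsWithin).exists
  exact ⟨η, hη0, hη⟩

theorem exists_pos_lt_perturbed [IsFiniteMeasure Q] {W n : X → ℝ} (hW : Measurable W)
    (hn : Measurable n) (hatom : ∀ c, Q {x | W x = c} = 0) {c p : ℝ}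
    (h : p < Q.real {x | W x ≤ c}) : ∃ η > 0, p < Q.real {x | W x + η * n x ≤ c} := by
  have hu : Tendsto (fun η : ℝ => ((η, c) : ℝ × ℝ)) (𝓝[>] 0) (𝓝 (0, c)) := by
    have : Continuous fun η : ℝ => ((η, c) : ℝ × ℝ) := by fun_prop
    exact (this.tendsto 0).mono_left nhdsWithin_le_nhds
  obtain ⟨η, hη, hη0⟩ := (((tendsto_measureReal_perturbed_le hW hn hatom c).comp
    hu).eventually_const_lt h |>.and self_mem_nhdsWithin).exists
  exact ⟨η, hη0, hη⟩

end Perturbation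

end FewTreatedDID

/-! ### Coverage and consistency of the bootstrap -/

namespace FewTreatedDID

section Sandwich

variable {Ω ι : Type*} [MeasurableSpace Ω] {P : Measure Ω} [IsProbabilityMeasure P] {l : Filter ι}

/-- Coverage by a consistent critical value. The statistic `M` is asymptotically equal to the
atomless `W`, and the random critical value `q` is eventually on the correct side of each number that
is not a `p`-quantile of `W`. As the distribution function of `W` takes all values in `(0, 1)`, the
event `M ≤ q` is squeezed between events `W ≤ c` of probability close to `p`, although the quantile
of `W` need not be unique. -/
theorem tendsto_measureReal_le_critical {M q τ : ι × Ω → ℝ} {W n : Ω → ℝ} {p : ℝ} (hp0 : 0 < p)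
    (hp1 : p < 1) (hW : Measurable W) (hn : Measurable n) (hn0 : ∀ ω, 0 ≤ n ω)
    (hatom : ∀ c, P {ω | W ω = c} = 0)
    (hlower : ∀ c, P.real {ω | W ω ≤ c} < p → ∀ᶠ x in inProb P l, c ≤ q x)
    (hupper : ∀ c, p < P.real {ω | W ω ≤ c} → ∀ᶠ x in inProb P l, q x ≤ c)
    (hτ : Tendsto τ (inProb P l) (𝓝 0)) (hM : ∀ x, |M x - W x.2| ≤ τ x * n x.2)
    {S : ι → Set Ω} (hS : ∀ᶠ x in inProb P l, x.2 ∈ S x.1 ↔ M x ≤ q x) :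
    Tendsto (fun i => P.real (S i)) l (𝓝 p) := by
  rw [tendsto_order]
  constructor
  · intro a ha
    by_cases ha0 : a < 0
    · exact Eventually.of_forall fun n => ha0.trans_le measureReal_nonneg
    obtain ⟨y, hay, hy⟩ := exists_between ha
    obtain ⟨c, hc⟩ := exists_measureReal_le_eq hW hatom (y := y) (by linarith) (by linarith)
    obtain ⟨η, hη0, hη⟩ := exists_pos_lt_perturbed hW hn hatom (hay.trans_eq hc.symm)
    have himp : ∀ᶠ x in inProb P l, x.2 ∈ {ω | W ω + η * n ω ≤ c} → x.2 ∈ S x.1 := by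
      filter_upwards [hlower c (by rw [hc]; exact hy), hτ.eventually_lt_const hη0, hS]
        with x hq hτx hSx hmem
      have hmem' : W x.2 + η * n x.2 ≤ c := hmem
      refine hSx.2 (le_trans ?_ hq)
      have h1 := abs_le.1 (hM x)
      have h2 : τ x * n x.2 ≤ η * n x.2 := mul_le_mul_of_nonneg_right hτx.le (hn0 _)
      linarith [h1.2]
    filter_upwards [eventually_le_measureReal_of_imp himp (half_pos (sub_pos.2 hη))] with i hi
    linarith
  · intro a ha
    by_cases ha1 : 1 < a
    · exact Eventually.of_forall fun n => measureReal_le_one.trans_lt ha1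
    obtain ⟨y, hy, hya⟩ := exists_between ha
    obtain ⟨c, hc⟩ := exists_measureReal_le_eq hW hatom (y := y) (by linarith) (by linarith)
    obtain ⟨η, hη0, hη⟩ := exists_pos_perturbed_lt hW hn hatom (hc.trans_lt hya)
    have himp : ∀ᶠ x in inProb P l, x.2 ∈ S x.1 → x.2 ∈ {ω | W ω + -η * n ω ≤ c} := by
      filter_upwards [hupper c (by rw [hc]; exact hy), hτ.eventually_lt_const hη0, hS]
        with x hq hτx hSx hmem
      have h0 := (hSx.1 hmem).trans hq
      have h1 := abs_le.1 (hM x)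
      have h2 : τ x * n x.2 ≤ η * n x.2 := mul_le_mul_of_nonneg_right hτx.le (hn0 _)
      show W x.2 + -η * n x.2 ≤ c
      linarith [h1.1]
    filter_upwards [eventually_measureReal_le_of_imp himp (half_pos (sub_pos.2 hη))] with i hi
    linarith

end Sandwich

section EstimationError

variable {N₁ T K : ℕ} {𝒵 Ω : Type*} [MeasurableSpace Ω] {P : Measure Ω}
  {D : Design N₁ T K 𝒵} {U : Unobserved N₁ T Ω} {ξ : PanelUnit N₁ → Fin N₁ → Ω → Fin K → ℝ}
  {E : ParamEstimator D} {draw : ℕ → ℕ → Fin N₁ → Ω → ℕ}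

theorem exists_norm_aggregate_le (hR : Regularity P D E U) :
    ∃ C : ℝ, 0 ≤ C ∧ ∀ x, ‖aggregate D x‖ ≤ C * ‖x‖ := by
  obtain ⟨c, h, hc, hch, hmin, hmax⟩ := hR.bounds
  have hh0 : 0 < h := hc.trans_le hch
  exact ⟨N₁ * (√K * h), by positivity,
    norm_aggregate_le fun j => hmax j _ (inl_mem_ownAndControls j)⟩

theorem memLp_aggregate (hS : Sampling P U) (hM : ParametricModel P D U ξ) (s : Fin K) :
    MemLp (fun ω => aggregate D (ownShocks D U ω) s) 2 P := by
  simp_rw [aggregate_ownShocks hM, Finset.sum_apply]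
  exact memLp_finsetSum _ fun j _ => memLp_mulVec_shock hS _ _ s

/-- Coverage compares the studentized estimation error with the critical value. -/
theorem target_mem_band_iff (hT : ParallelTrends P D U) (hM : ParametricModel P D U ξ)
    (hK : 0 < K) {N₀ B : ℕ} (hN₀ : 0 < N₀) {α : ℝ} {ι : Fin K → ℝ} (hι : ∀ s, 0 < ι s) (ω : Ω) :
    D.target ∈ band E U draw N₀ B α ι ω ↔
      maxRatio (aggregate D (ownShocks D U ω) - ∑ j, meanShock D U N₀ j ω) ι
        ≤ critValue E U draw N₀ B α ι ω := by
  rw [← estimator_sub_target hT hM hN₀, maxRatio_le_iff hK, band, Set.mem_univ_pi]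
  refine forall_congr' fun s => ?_
  rw [abs_div, abs_of_pos (hι s), div_le_iff₀ (hι s), abs_le, Set.mem_Icc, Pi.sub_apply, mul_comm]
  constructor <;> rintro ⟨h1, h2⟩ <;> constructor <;> linarith

end EstimationError

section Conclusion

variable {N₁ T K : ℕ} {𝒵 Ω : Type*} [MeasurableSpace Ω] {P : Measure Ω} [IsProbabilityMeasure P]
  {D : Design N₁ T K 𝒵} {U : Unobserved N₁ T Ω} {ξ : PanelUnit N₁ → Fin N₁ → Ω → Fin K → ℝ}
  {E : ParamEstimator D} {draw : ℕ → ℕ → Fin N₁ → Ω → ℕ}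

/-- The bound on the bootstrap errors along the joint limit `N₀, B → ∞`. -/
theorem exists_bootError_bound_prod (hS : Sampling P U)
    (hT : ParallelTrends P D U) (hM : ParametricModel P D U ξ) (hR : Regularity P D E U)
    (hD : BootstrapDraws P U draw) :
    ∃ r : (ℕ × ℕ) × Ω → ℝ, Tendsto r (inProb P (atTop ×ˢ atTop)) (𝓝 0) ∧
      ∀ᶠ p in inProb P (atTop ×ˢ atTop), ∀ b,
        ‖bootError E U draw p.1.1 b p.2 - aggregate D (drawnShocks D U draw p.1.1 b p.2)‖
          ≤ r p * (1 + ‖drawnShocks D U draw p.1.1 b p.2‖) := by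
  obtain ⟨r, hr, hb⟩ := exists_bootError_bound hS hT hM hR hD
  have hfst : Tendsto (fun p : (ℕ × ℕ) × Ω => (p.1.1, p.2)) (inProb P (atTop ×ˢ atTop))
      (inProb P atTop) := tendsto_inProb_of_index tendsto_fst
  exact ⟨fun p => r (p.1.1, p.2), hr.comp hfst, hfst.eventually hb⟩

/-- The law of large numbers for functions of quadratic growth of the resampled shocks. -/
theorem tendsto_average_drawnShocks (hS : Sampling P U) (hM : ParametricModel P D U ξ)
    (hD : BootstrapDraws P U draw) {f : (Fin N₁ → Fin K → ℝ) → ℝ} (hf : Measurable f) {C : ℝ}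
    (hC : ∀ x, |f x| ≤ C * (1 + ‖x‖) ^ 2) :
    Tendsto (fun p : (ℕ × ℕ) × Ω =>
        (∑ b ∈ Finset.range p.1.2, f (drawnShocks D U draw p.1.1 b p.2)) / p.1.2)
      (inProb P (atTop ×ˢ atTop)) (𝓝 (∫ ω, f (ownShocks D U ω) ∂P)) := by
  have := isProbabilityMeasure_shockLaw (D := D) hS
  rw [← integral_map (measurable_ownShocks hS).aemeasurable hf.aestronglyMeasurable,
    map_ownShocks hS]
  exact (resampling_normShock hS hM hD).tendsto_average (fun j => integrable_shockLaw hS j) hf hC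

/-- If `f` differs from `g` on the resampled data by at most `ρ (1 + ‖x‖)²` with `ρ → 0`, both have
the same limiting averages. -/
theorem tendsto_average_of_close (hS : Sampling P U) (hM : ParametricModel P D U ξ)
    (hD : BootstrapDraws P U draw) {g : (Fin N₁ → Fin K → ℝ) → ℝ} (hg : Measurable g) {C : ℝ}
    (hC : ∀ x, |g x| ≤ C * (1 + ‖x‖) ^ 2) {f : (ℕ × ℕ) × Ω → ℕ → ℝ} {ρ : (ℕ × ℕ) × Ω → ℝ}
    (hρ : Tendsto ρ (inProb P (atTop ×ˢ atTop)) (𝓝 0))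
    (hfg : ∀ᶠ p in inProb P (atTop ×ˢ atTop), ∀ b,
      |f p b - g (drawnShocks D U draw p.1.1 b p.2)|
        ≤ ρ p * (1 + ‖drawnShocks D U draw p.1.1 b p.2‖) ^ 2) :
    Tendsto (fun p : (ℕ × ℕ) × Ω => (∑ b ∈ Finset.range p.1.2, f p b) / p.1.2)
      (inProb P (atTop ×ˢ atTop)) (𝓝 (∫ ω, g (ownShocks D U ω) ∂P)) := by
  have h1 := tendsto_average_drawnShocks hS hM hD hg hC
  have h2 := tendsto_average_drawnShocks hS hM hD (f := fun x => (1 + ‖x‖) ^ 2) (by fun_prop)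
    (C := 1) fun x => by rw [one_mul, abs_of_nonneg (by positivity)]
  have h3 := hρ.mul h2
  rw [zero_mul] at h3
  have h4 : Tendsto (fun p : (ℕ × ℕ) × Ω => (∑ b ∈ Finset.range p.1.2, f p b) / p.1.2
      - (∑ b ∈ Finset.range p.1.2, g (drawnShocks D U draw p.1.1 b p.2)) / p.1.2)
      (inProb P (atTop ×ˢ atTop)) (𝓝 0) := by
    refine squeeze_zero_norm' ?_ h3
    filter_upwards [hfg] with p hp
    rw [Real.norm_eq_abs, ← sub_div, ← Finset.sum_sub_distrib, abs_div, Nat.abs_cast,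
      ← mul_div_assoc, Finset.mul_sum]
    gcongr
    exact (Finset.abs_sum_le_sum_abs _ _).trans (Finset.sum_le_sum fun b _ => hp b)
  simpa using h4.add h1

theorem limitVariance_eq (hS : Sampling P U) (hM : ParametricModel P D U ξ) (s : Fin K) :
    limitVariance P D U s = ∫ ω, aggregate D (ownShocks D U ω) s ^ 2 ∂P
      - (∫ ω, aggregate D (ownShocks D U ω) s ∂P) ^ 2 := by
  simp_rw [limitVariance, ← aggregate_ownShocks hM]
  exact variance_eq_sub (memLp_aggregate hS hM s)

theorem limitVariance_pos (hN₁ : 0 < N₁) (hS : Sampling P U) (hM : ParametricModel P D U ξ)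
    (s : Fin K) : 0 < limitVariance P D U s := by
  simp_rw [limitVariance, ← aggregate_ownShocks hM]
  refine (variance_nonneg _ _).lt_of_ne fun h0 => ?_
  have h1 := ae_eq_integral_of_variance_eq_zero (memLp_aggregate hS hM s) h0.symm
  have h2 := measure_eq_zero_iff_ae_notMem.1 (measure_aggregate_eq hN₁ hS hM s
    (∫ ω, aggregate D (ownShocks D U ω) s ∂P))
  obtain ⟨ω, h, h'⟩ := (h1.and h2).exists
  exact h' h

/-- Consistency of the bootstrap variances. -/
theorem tendsto_bootVariance (hS : Sampling P U)
    (hT : ParallelTrends P D U) (hM : ParametricModel P D U ξ) (hR : Regularity P D E U)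
    (hD : BootstrapDraws P U draw) (s : Fin K) :
    Tendsto (fun p : (ℕ × ℕ) × Ω => bootVariance E U draw p.1.1 p.1.2 s p.2)
      (inProb P (atTop ×ˢ atTop)) (𝓝 (limitVariance P D U s)) := by
  obtain ⟨r, hr, hb⟩ := exists_bootError_bound_prod hS hT hM hR hD
  obtain ⟨C, hC0, hC⟩ := exists_norm_aggregate_le hR
  have hms : Measurable fun x => aggregate D x s := (measurable_pi_apply s).comp measurable_aggregate
  have hCs : ∀ x, |aggregate D x s| ≤ C * (1 + ‖x‖) := fun x =>
    (norm_le_pi_norm (aggregate D x) s).trans ((hC x).trans (by gcongr; linarith))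
  have hsq : ∀ x : Fin N₁ → Fin K → ℝ, 1 + ‖x‖ ≤ (1 + ‖x‖) ^ 2 := fun x => by
    nlinarith [norm_nonneg x]
  have hbs : ∀ᶠ p in inProb P (atTop ×ˢ atTop), ∀ b,
      |bootError E U draw p.1.1 b p.2 s - aggregate D (drawnShocks D U draw p.1.1 b p.2) s|
        ≤ |r p| * (1 + ‖drawnShocks D U draw p.1.1 b p.2‖) := by
    filter_upwards [hb] with p hp b
    refine (norm_le_pi_norm (bootError E U draw p.1.1 b p.2
      - aggregate D (drawnShocks D U draw p.1.1 b p.2)) s).trans ((hp b).trans ?_)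
    gcongr
    exact le_abs_self _
  have hr' : Tendsto (fun p => |r p|) (inProb P (atTop ×ˢ atTop)) (𝓝 0) := by simpa using hr.abs
  have hmean := tendsto_average_of_close hS hM hD hms (C := C)
    (fun x => (hCs x).trans (by gcongr; exact hsq x))
    (f := fun p b => bootError E U draw p.1.1 b p.2 s) hr' (hbs.mono fun p hp b =>
      (hp b).trans (by gcongr; exact hsq _))
  have hρ : Tendsto (fun p => |r p| * (|r p| + 2 * C)) (inProb P (atTop ×ˢ atTop)) (𝓝 0) := by
    simpa using hr'.mul (hr'.add_const (2 * C))
  have hsquare := tendsto_average_of_close hS hM hD (hms.pow_const 2) (C := C ^ 2)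
    (fun x => by
      rw [abs_pow, ← mul_pow]
      gcongr
      exact hCs x)
    (f := fun p b => bootError E U draw p.1.1 b p.2 s ^ 2) hρ (hbs.mono fun p hp b => by
      set x := drawnShocks D U draw p.1.1 b p.2
      set e := bootError E U draw p.1.1 b p.2 s
      have h1 : |e + aggregate D x s| ≤ (|r p| + 2 * C) * (1 + ‖x‖) := by
        have h2 : e + aggregate D x s = (e - aggregate D x s) + 2 * aggregate D x s := by ring
        rw [h2]
        refine (abs_add_le _ _).trans ?_
        rw [abs_mul, abs_two]
        linarith [hp b, hCs x]
      have h3 : e ^ 2 - aggregate D x s ^ 2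
          = (e - aggregate D x s) * (e + aggregate D x s) := by ring
      rw [h3, abs_mul]
      calc _ ≤ (|r p| * (1 + ‖x‖)) * ((|r p| + 2 * C) * (1 + ‖x‖)) :=
            mul_le_mul (hp b) h1 (abs_nonneg _) ((abs_nonneg _).trans (hp b))
        _ = _ := by ring)
  rw [limitVariance_eq hS hM]
  refine (hsquare.sub (hmean.pow 2)).congr' ?_
  filter_upwards [eventually_inProb_of_eventually (P := P) eventually_pos_prod] with p hp
  exact (empVariance_eq hp.2 _).symm

/-- The studentized maximum equals `c` only if some coordinate equals `± c ι_s`. -/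
theorem measure_maxRatio_aggregate_eq (hN₁ : 0 < N₁) (hK : 0 < K) (hS : Sampling P U)
    (hM : ParametricModel P D U ξ) {ι : Fin K → ℝ} (hι : ∀ s, 0 < ι s) (c : ℝ) :
    P {ω | maxRatio (aggregate D (ownShocks D U ω)) ι = c} = 0 := by
  have : Nonempty (Fin K) := ⟨⟨0, hK⟩⟩
  have hsub : {ω | maxRatio (aggregate D (ownShocks D U ω)) ι = c} ⊆
      ⋃ s, ({ω | aggregate D (ownShocks D U ω) s = c * ι s} ∪
        {ω | aggregate D (ownShocks D U ω) s = -c * ι s}) := by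
    intro ω (hω : maxRatio _ ι = c)
    obtain ⟨s, hs⟩ := exists_eq_ciSup_of_finite
      (f := fun s => |aggregate D (ownShocks D U ω) s / ι s|)
    have hs' : |aggregate D (ownShocks D U ω) s / ι s| = c := hs.trans hω
    refine Set.mem_iUnion.2 ⟨s, ?_⟩
    rcases abs_choice (aggregate D (ownShocks D U ω) s / ι s) with h | h
    · exact Or.inl ((div_eq_iff (hι s).ne').1 (h.symm.trans hs'))
    · refine Or.inr ((div_eq_iff (hι s).ne').1 ?_)
      linarith
  refine measure_mono_null hsub (measure_iUnion_null fun s => measure_union_null ?_ ?_)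
  · exact measure_aggregate_eq hN₁ hS hM s _
  · exact measure_aggregate_eq hN₁ hS hM s _

/-- The bootstrap critical value: it eventually exceeds each `c` at which the limiting distribution
function is below `1 - α`, and eventually falls below each `c` at which it is above. -/
theorem eventually_critValue (hN₁ : 0 < N₁) (hK : 0 < K) (hS : Sampling P U)
    (hM : ParametricModel P D U ξ)
    (hD : BootstrapDraws P U draw) {α : ℝ} (hα₀ : 0 < α) (hα₁ : α < 1) {ι : Fin K → ℝ}
    (hι : ∀ s, 0 < ι s) {ιHat : ℕ → ℕ → Ω → Fin K → ℝ} {ρ : (ℕ × ℕ) × Ω → ℝ}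
    (hρ : Tendsto ρ (inProb P (atTop ×ˢ atTop)) (𝓝 0))
    (hclose : ∀ᶠ p in inProb P (atTop ×ˢ atTop), ∀ b,
      |maxRatio (bootError E U draw p.1.1 b p.2) (ιHat p.1.1 p.1.2 p.2)
        - maxRatio (aggregate D (drawnShocks D U draw p.1.1 b p.2)) ι|
        ≤ ρ p * (1 + ‖drawnShocks D U draw p.1.1 b p.2‖)) (c : ℝ) :
    (P.real {ω | maxRatio (aggregate D (ownShocks D U ω)) ι ≤ c} < 1 - α →
      ∀ᶠ p in inProb P (atTop ×ˢ atTop),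
        c ≤ critValue E U draw p.1.1 p.1.2 α (ιHat p.1.1 p.1.2 p.2) p.2) ∧
    (1 - α < P.real {ω | maxRatio (aggregate D (ownShocks D U ω)) ι ≤ c} →
      ∀ᶠ p in inProb P (atTop ×ˢ atTop),
        critValue E U draw p.1.1 p.1.2 α (ιHat p.1.1 p.1.2 p.2) p.2 ≤ c) := by
  classical
  let W : (Fin N₁ → Fin K → ℝ) → ℝ := fun x => maxRatio (aggregate D x) ι
  have hWm : Measurable W := (measurable_maxRatio ι).comp measurable_aggregate
  have hWm' : Measurable fun ω => W (ownShocks D U ω) := hWm.comp (measurable_ownShocks hS)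
  have hnm' : Measurable fun ω => 1 + ‖ownShocks D U ω‖ := (measurable_ownShocks hS).norm.const_add 1
  have hatom := measure_maxRatio_aggregate_eq hN₁ hK hS hM hι
  -- the empirical frequency of a perturbed event converges to its limiting probability
  have hfreq : ∀ η : ℝ, Tendsto (fun p : (ℕ × ℕ) × Ω =>
      (∑ b ∈ Finset.range p.1.2, if W (drawnShocks D U draw p.1.1 b p.2)
        + η * (1 + ‖drawnShocks D U draw p.1.1 b p.2‖) ≤ c then (1 : ℝ) else 0) / p.1.2)
      (inProb P (atTop ×ˢ atTop))
      (𝓝 (P.real {ω | W (ownShocks D U ω) + η * (1 + ‖ownShocks D U ω‖) ≤ c})) := by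
    intro η
    have hset : MeasurableSet {x : Fin N₁ → Fin K → ℝ | W x + η * (1 + ‖x‖) ≤ c} :=
      measurableSet_le (hWm.add (by fun_prop)) measurable_const
    have h1 := tendsto_average_drawnShocks hS hM hD
      (f := fun x => if W x + η * (1 + ‖x‖) ≤ c then (1 : ℝ) else 0)
      (Measurable.ite hset measurable_const measurable_const) (C := 1) fun x => by
        have : 1 ≤ (1 + ‖x‖) ^ 2 := by nlinarith [norm_nonneg x]
        split_ifs
        · simpa using this
        · simp only [abs_zero]; positivity
    have h2 : ∫ ω, (if W (ownShocks D U ω) + η * (1 + ‖ownShocks D U ω‖) ≤ c then (1 : ℝ) else 0) ∂P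
        = P.real {ω | W (ownShocks D U ω) + η * (1 + ‖ownShocks D U ω‖) ≤ c} :=
      integral_indicator_one (μ := P)
        (s := {ω | W (ownShocks D U ω) + η * (1 + ‖ownShocks D U ω‖) ≤ c})
        (measurable_ownShocks hS hset)
    rw [h2] at h1
    exact h1
  constructor
  · intro hlt
    obtain ⟨η, hη0, hη⟩ := exists_pos_perturbed_lt hWm' hnm' hatom hlt
    filter_upwards [hclose, hρ.eventually_lt_const hη0, (hfreq (-η)).eventually_lt_const hη,
      eventually_inProb_of_eventually (P := P) eventually_pos_prod] with p hp hρp hF hpos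
    refine le_empQuantile hpos.2 (by linarith) ?_
    rw [card_filter_div_eq_average]
    refine lt_of_le_of_lt ?_ hF
    gcongr with b _
    have h1 := abs_le.1 (hp b)
    have h2 : ρ p * (1 + ‖drawnShocks D U draw p.1.1 b p.2‖)
        ≤ η * (1 + ‖drawnShocks D U draw p.1.1 b p.2‖) := by gcongr
    have h3 : maxRatio (bootError E U draw p.1.1 b p.2) (ιHat p.1.1 p.1.2 p.2) ≤ c →
        W (drawnShocks D U draw p.1.1 b p.2)
          + -η * (1 + ‖drawnShocks D U draw p.1.1 b p.2‖) ≤ c := fun h => by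
      simp only [W]
      linarith [h1.1]
    change (if maxRatio (bootError E U draw p.1.1 b p.2) (ιHat p.1.1 p.1.2 p.2) ≤ c
      then (1 : ℝ) else 0) ≤ _
    split_ifs with ha hb
    · exact le_rfl
    · exact absurd (h3 ha) hb
    · exact zero_le_one
    · exact le_rfl
  · intro hlt
    obtain ⟨η, hη0, hη⟩ := exists_pos_lt_perturbed hWm' hnm' hatom hlt
    filter_upwards [hclose, hρ.eventually_lt_const hη0, (hfreq η).eventually_const_lt hη]
      with p hp hρp hF
    refine empQuantile_le (by linarith) (fun b => maxRatio_nonneg _ _) ?_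
    rw [card_filter_div_eq_average]
    refine hF.le.trans ?_
    gcongr with b _
    have h1 := abs_le.1 (hp b)
    have h2 : ρ p * (1 + ‖drawnShocks D U draw p.1.1 b p.2‖)
        ≤ η * (1 + ‖drawnShocks D U draw p.1.1 b p.2‖) := by gcongr
    have h3 : W (drawnShocks D U draw p.1.1 b p.2)
          + η * (1 + ‖drawnShocks D U draw p.1.1 b p.2‖) ≤ c →
        maxRatio (bootError E U draw p.1.1 b p.2) (ιHat p.1.1 p.1.2 p.2) ≤ c := fun h => by
      simp only [W] at h
      linarith [h1.2]
    change _ ≤ (if maxRatio (bootError E U draw p.1.1 b p.2) (ιHat p.1.1 p.1.2 p.2) ≤ c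
      then (1 : ℝ) else 0)
    split_ifs with ha hb
    · exact le_rfl
    · exact absurd (h3 ha) hb
    · exact zero_le_one
    · exact le_rfl

/-- Asymptotic coverage for consistent normalizing constants, which need not be measurable. -/
theorem tendsto_coverage (hN₁ : 0 < N₁) (hK : 0 < K) (hS : Sampling P U)
    (hT : ParallelTrends P D U) (hM : ParametricModel P D U ξ) (hR : Regularity P D E U)
    (hD : BootstrapDraws P U draw) {α : ℝ} (hα₀ : 0 < α) (hα₁ : α < 1) {ι : Fin K → ℝ}
    (hι : ∀ s, 0 < ι s) {ιHat : ℕ → ℕ → Ω → Fin K → ℝ}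
    (hιHat : ∀ s, Tendsto (fun p : (ℕ × ℕ) × Ω => ιHat p.1.1 p.1.2 p.2 s)
      (inProb P (atTop ×ˢ atTop)) (𝓝 (ι s))) :
    Tendsto (fun n : ℕ × ℕ =>
        P.real {ω | D.target ∈ band E U draw n.1 n.2 α (ιHat n.1 n.2 ω) ω})
      (atTop ×ˢ atTop) (𝓝 (1 - α)) := by
  obtain ⟨r, hr, hb⟩ := exists_bootError_bound_prod hS hT hM hR hD
  obtain ⟨C, hC0, hC⟩ := exists_norm_aggregate_le hR
  obtain ⟨_, h, _, _, _, hmax⟩ := hR.bounds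
  have hinv : ∀ s, Tendsto (fun p : (ℕ × ℕ) × Ω => (ιHat p.1.1 p.1.2 p.2 s)⁻¹)
      (inProb P (atTop ×ˢ atTop)) (𝓝 (ι s)⁻¹) := fun s => (hιHat s).inv₀ (hι s).ne'
  have hsum1 := tendsto_finsetSum Finset.univ fun s (_ : s ∈ Finset.univ) => (hinv s).abs
  have hsum2 : Tendsto (fun p : (ℕ × ℕ) × Ω => ∑ s, |(ιHat p.1.1 p.1.2 p.2 s)⁻¹ - (ι s)⁻¹|)
      (inProb P (atTop ×ˢ atTop)) (𝓝 0) := by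
    simpa using tendsto_finsetSum Finset.univ fun s (_ : s ∈ Finset.univ) =>
      ((hinv s).sub_const (ι s)⁻¹).abs
  have hpert : ∀ {r' : (ℕ × ℕ) × Ω → ℝ}, Tendsto r' (inProb P (atTop ×ˢ atTop)) (𝓝 0) →
      Tendsto (fun p => r' p * (∑ s, |(ιHat p.1.1 p.1.2 p.2 s)⁻¹|)
        + C * ∑ s, |(ιHat p.1.1 p.1.2 p.2 s)⁻¹ - (ι s)⁻¹|) (inProb P (atTop ×ˢ atTop)) (𝓝 0) := by
    intro r' hr'
    simpa using (hr'.mul hsum1).add (hsum2.const_mul C)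
  have hcrit := eventually_critValue hN₁ hK hS hM hD hα₀ hα₁ hι (hpert hr)
    (hb.mono fun p hp b => abs_maxRatio_sub_le_mul hK hC0 (hp b) (hC _))
  -- the same comparison for the estimation error, whose centring error is the control mean
  have hmean : Tendsto (fun p : (ℕ × ℕ) × Ω => ‖∑ j, meanShock D U p.1.1 j p.2‖)
      (inProb P (atTop ×ˢ atTop)) (𝓝 0) := by
    have h1 := tendsto_finsetSum Finset.univ fun j (_ : j ∈ Finset.univ) =>
      tendsto_meanShock hS hM hmax j
    have hfst : Tendsto (fun p : (ℕ × ℕ) × Ω => (p.1.1, p.2)) (inProb P (atTop ×ˢ atTop))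
        (inProb P atTop) := tendsto_inProb_of_index tendsto_fst
    have h2 := h1.norm.comp hfst
    simp only [Finset.sum_const_zero, norm_zero] at h2
    exact h2
  set τ : (ℕ × ℕ) × Ω → ℝ := fun p => ‖∑ j, meanShock D U p.1.1 j p.2‖
      * (∑ s, |(ιHat p.1.1 p.1.2 p.2 s)⁻¹|)
        + C * ∑ s, |(ιHat p.1.1 p.1.2 p.2 s)⁻¹ - (ι s)⁻¹| with hτ
  have hτ0 : Tendsto τ (inProb P (atTop ×ˢ atTop)) (𝓝 0) := hpert hmean
  have hstat : ∀ p : (ℕ × ℕ) × Ω, |maxRatio (aggregate D (ownShocks D U p.2)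
      - ∑ j, meanShock D U p.1.1 j p.2) (ιHat p.1.1 p.1.2 p.2)
      - maxRatio (aggregate D (ownShocks D U p.2)) ι| ≤ τ p * (1 + ‖ownShocks D U p.2‖) := fun p =>
    abs_maxRatio_sub_le_mul hK hC0 (by
      rw [sub_sub_cancel_left, norm_neg]
      exact le_mul_of_one_le_right (norm_nonneg _) (by linarith [norm_nonneg (ownShocks D U p.2)]))
      (hC _)
  have hιpos : ∀ᶠ p in inProb P (atTop ×ˢ atTop), ∀ s, 0 < ιHat p.1.1 p.1.2 p.2 s :=
    eventually_all.2 fun s => (hιHat s).eventually_const_lt (hι s)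
  have hpos := eventually_inProb_of_eventually (P := P) eventually_pos_prod
  have hWm : Measurable fun ω => maxRatio (aggregate D (ownShocks D U ω)) ι :=
    ((measurable_maxRatio ι).comp measurable_aggregate).comp (measurable_ownShocks hS)
  have hnm : Measurable fun ω => 1 + ‖ownShocks D U ω‖ := (measurable_ownShocks hS).norm.const_add 1
  have hatom := measure_maxRatio_aggregate_eq hN₁ hK hS hM hι
  refine tendsto_measureReal_le_critical
    (M := fun p : (ℕ × ℕ) × Ω => maxRatio (aggregate D (ownShocks D U p.2)
      - ∑ j, meanShock D U p.1.1 j p.2) (ιHat p.1.1 p.1.2 p.2))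
    (q := fun p => critValue E U draw p.1.1 p.1.2 α (ιHat p.1.1 p.1.2 p.2) p.2) (τ := τ)
    (W := fun ω => maxRatio (aggregate D (ownShocks D U ω)) ι)
    (n := fun ω => 1 + ‖ownShocks D U ω‖)
    (S := fun n => {ω | D.target ∈ band E U draw n.1 n.2 α (ιHat n.1 n.2 ω) ω})
    (by linarith) (by linarith) hWm hnm (fun ω => by positivity) hatom (fun c => (hcrit c).1)
    (fun c => (hcrit c).2) hτ0 hstat ?_
  filter_upwards [hιpos, hpos] with p hιp hp0
  exact target_mem_band_iff hT hM hK hp0.1 hιp p.2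

end Conclusion

end FewTreatedDID

theorem corollary1 {N₁ T K : ℕ} {𝒵 Ω : Type*} [MeasurableSpace Ω] (P : Measure Ω)
    [IsProbabilityMeasure P] (hN₁ : 0 < N₁) (hK : 0 < K)
    (D : Design N₁ T K 𝒵) (U : Unobserved N₁ T Ω)
    (ξ : PanelUnit N₁ → Fin N₁ → Ω → Fin K → ℝ)
    (E : ParamEstimator D) (draw : ℕ → ℕ → Fin N₁ → Ω → ℕ)
    (hSampling : Sampling P U) (hTrends : ParallelTrends P D U)
    (hModel : ParametricModel P D U ξ) (hReg : Regularity P D E U)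
    (hDraws : BootstrapDraws P U draw)
    (α : ℝ) (hα₀ : 0 < α) (hα₁ : α < 1) :
    -- coverage of the band with arbitrary consistent normalizing constants
    (∀ (ι : Fin K → ℝ) (ιHat : ℕ → ℕ → Ω → Fin K → ℝ),
        (∀ s, 0 < ι s) → (∀ N₀ B, Measurable (ιHat N₀ B)) →
        (∀ s, TendstoInMeasure P (fun (n : ℕ × ℕ) ω => ιHat n.1 n.2 ω s) (atTop ×ˢ atTop)
          fun _ => ι s) →
        Tendsto (fun n : ℕ × ℕ =>
            P.real {ω | D.target ∈ band E U draw n.1 n.2 α (ιHat n.1 n.2 ω) ω})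
          (atTop ×ˢ atTop) (𝓝 (1 - α))) ∧
    -- consistency of the bootstrap variance estimators
    (∀ s, 0 < limitVariance P D U s ∧
        TendstoInMeasure P (fun (n : ℕ × ℕ) ω => bootVariance E U draw n.1 n.2 s ω)
          (atTop ×ˢ atTop) fun _ => limitVariance P D U s) ∧
    -- coverage of the band with the bootstrap standard deviations as normalizing constants
    Tendsto (fun n : ℕ × ℕ =>
        P.real {ω | D.target ∈
          band E U draw n.1 n.2 α (fun s => Real.sqrt (bootVariance E U draw n.1 n.2 s ω)) ω})
      (atTop ×ˢ atTop) (𝓝 (1 - α)) := by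
  have hvar := fun s => tendsto_bootVariance hSampling hTrends hModel hReg hDraws s
  have hpos := fun s => limitVariance_pos hN₁ hSampling hModel s
  refine ⟨fun ι ιHat hι _ hιHat => ?_, fun s => ⟨hpos s, ?_⟩, ?_⟩
  · exact tendsto_coverage hN₁ hK hSampling hTrends hModel hReg hDraws hα₀ hα₁ hι fun s =>
      (tendstoInMeasure_const_iff (f := fun (n : ℕ × ℕ) ω => ιHat n.1 n.2 ω s)).1 (hιHat s)
  · exact (tendstoInMeasure_const_iff
      (f := fun (n : ℕ × ℕ) ω => bootVariance E U draw n.1 n.2 s ω)).2 (hvar s)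
  · exact tendsto_coverage hN₁ hK hSampling hTrends hModel hReg hDraws hα₀ hα₁
      (ι := fun s => √(limitVariance P D U s))
      (ιHat := fun N₀ B ω s => √(bootVariance E U draw N₀ B s ω))
      (fun s => Real.sqrt_pos.2 (hpos s)) fun s => (hvar s).sqrt
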